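/- Let $\mathfrak n$ be a non-abelian real Lie algebra of dimension $n$ with a basis $Z_1,\dots,Z_{n-2d},Y_1,\dots,Y_d,X_1,\dots,X_d$ such that $\operatorname{span}\{Z_k\}$ is the centre $\mathfrak z(\mathfrak n)$, $[Y_i,Y_j]=[X_i,X_j]=0$, $[X_i,Y_j]\in\mathfrak z(\mathfrak n)$ for all $i,j$, and $\lambda\mapsto\det(\lambda[X_i,Y_j])_{i,j}$ is a nonzero polynomial on $\mathfrak n^*$. Let $N=\exp\mathfrak n$ be the connected, simply connected Lie group of $\mathfrak n$, with Haar measure equal to Lebesgue measure in the coordinates $(z,y,x)\mapsto\exp(\sum z_kZ_k)\exp(\sum y_iY_i)\exp(\sum x_iX_i)$, and let $(L(a)f)(b)=f(a^{-1}b)$ on $L^2(N)$. Put $\Gamma=\exp(\sum\mathbb ZZ_k)\exp(\sum\mathbb ZY_i)\exp(\sum\mathbb ZX_i)$. Let $A\in\mathrm{Aut}(N)$ be the automorphism whose differential is $Z_k\mapsto2Z_k$, $Y_i\mapsto2Y_i$, $X_i\mapsto X_i$, and for $j\in\mathbb Z$ let $(D_{A^j}f)(a)=2^{-j(n-d)/2}f(A^{-j}a)$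 on $L^2(N)$. Identify $\lambda\in\mathbb R^{n-2d}$ with the functional on $\mathfrak n$ with values $\lambda_k$ at $Z_k$ and $0$ at all $Y_i,X_i$; let $B(\lambda)=(\lambda[X_i,Y_j])_{i,j}$ and $\Sigma=\{\lambda\in\mathbb R^{n-2d}:\det B(\lambda)\ne0\}$. For $\lambda\in\Sigma$ let $\pi_\lambda$ be the irreducible unitary representation of $N$ on $L^2(\mathbb R^d)$ given by $$\pi_\lambda\Big(\exp(\textstyle\sum z_kZ_k)\exp(\sum y_iY_i)\exp(\sum x_iX_i)\Big)\phi(t)=e^{2\pi i\langle\lambda,z\rangle}e^{-2\pi i\langle t,B(\lambda)y\rangle}\phi(t-x).$$ Let $\mathcal P$ be the Plancherel transform of $N$, i.e. the continuous extension to $L^2(N)$ of $\mathcal Ff(\lambda)=\int_Nf(a)\pi_\lambda(a)\,da$ (weakly defined, $f\in L^1(N)\cap L^2(N)$), with values in $\int_\Sigma^\oplus L^2(\mathbb R^d)\otimes L^2(\mathbb R^d)\,|\det B(\lambda)|\,d\lambda$, the space of square-integrable fields of Hilbert–Schmidt operators ($\phi\otimes u$ is the operator $v\mapsto\langle v,u\rangle\phi$).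 Fix $u\in L^2(\mathbb R^d)$ with $\|u\|=1$, let $E=\big([-\tfrac12,\tfrac12]^{n-2d}\setminus[-\tfrac14,\tfrac14]^{n-2d}\big)\cap\Sigma$, and $$\mathbf H_E=\mathcal P^{-1}\Big(\int_E^\oplus (L^2(\mathbb R^d)\otimes u)\,|\det B(\lambda)|\,d\lambda\Big),\qquad \mathbf H_E^j=\mathcal P^{-1}\Big(\int_{2^{-j}E}^\oplus (L^2(\mathbb R^d)\otimes u)\,|\det B(\lambda)|\,d\lambda\Big)\quad(j\in\mathbb Z).$$ A family $(v_i)$ in a Hilbert space $W$ is a Parseval frame for $W$ if $\sum_i|\langle g,v_i\rangle|^2=\|g\|^2$ for all $g\in W$. Then: 1. $L(A^j\gamma)D_{A^j}=D_{A^j}L(\gamma)$ for all $j\in\mathbb Z$ and all $\gamma\in N$ (in particular all $\gamma\in\Gamma$). 2. If $f\in L^2(N)$ is such that $\{L(\gamma)f:\gamma\in\Gamma\}$ is a Parseval frame for $\mathbf H_E$, then for every $j\in\mathbb Z$ the system $\{L(A^j\gamma)D_{A^j}f:\gamma\in\Gamma\}$ is a Parseval frame for $\mathbf H_E^j$. 3.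 $(D_{A^j}L(\Gamma))(\mathbf H_E)=\{D_{A^j}L(\gamma)h:\gamma\in\Gamma,\ h\in\mathbf H_E\}=\mathbf H_E^j$ for every $j\in\mathbb Z$. 4. $\mathbf H_E^j\perp\mathbf H_E^{j'}$ whenever $j\ne j'$. 5. The Hilbert space direct sum of these spaces, i.e. the closure in $L^2(N)$ of the span of the mutually orthogonal subspaces $\mathbf H_E^j$, is $$\bigoplus_{j\in\mathbb Z}\mathbf H_E^j=\mathcal P^{-1}\Big(\int_\Sigma^\oplus (L^2(\mathbb R^d)\otimes u)\,|\det B(\lambda)|\,d\lambda\Big).$$ -/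

import Mathlib

open MeasureTheory
open scoped ComplexConjugate ENNReal

noncomputable section

namespace NilWavelet

/-- A basis `Z₁,…,Z_m, Y₁,…,Y_d, X₁,…,X_d` of a real Lie algebra (so `dim 𝔫 = n = m + 2d`) with
`𝔷(𝔫) = span Z`, with `span (Z, Y)` and `span X` abelian, `[𝔞, 𝔟] ⊆ 𝔷(𝔫)`, and such that
`ℓ ↦ det (ℓ[X_i, Y_j])` is a nonzero polynomial function. -/
structure JHBasis (𝔫 : Type*) [LieRing 𝔫] [LieAlgebra ℝ 𝔫] (m d : ℕ) where
  basis : Module.Basis (Fin m ⊕ Fin d ⊕ Fin d) ℝ 𝔫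
  span_Z : Submodule.span ℝ (Set.range fun k : Fin m => basis (.inl k)) =
    (LieAlgebra.center ℝ 𝔫).toSubmodule
  lie_Y_Y : ∀ i j : Fin d, ⁅basis (.inr (.inl i)), basis (.inr (.inl j))⁆ = 0
  lie_X_X : ∀ i j : Fin d, ⁅basis (.inr (.inr i)), basis (.inr (.inr j))⁆ = 0
  lie_X_Y : ∀ i j : Fin d,
    ⁅basis (.inr (.inr i)), basis (.inr (.inl j))⁆ ∈ LieAlgebra.center ℝ 𝔫
  det_ne_zero : ∃ ℓ : Module.Dual ℝ 𝔫,
    (Matrix.of fun i j : Fin d => ℓ ⁅basis (.inr (.inr i)), basis (.inr (.inl j))⁆).det ≠ 0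

namespace JHBasis

section LieAlgebraPart

variable {𝔫 : Type*} [LieRing 𝔫] [LieAlgebra ℝ 𝔫] {m d : ℕ} (J : JHBasis 𝔫 m d)

def Z (k : Fin m) : 𝔫 := J.basis (.inl k)
def Y (i : Fin d) : 𝔫 := J.basis (.inr (.inl i))
def X (i : Fin d) : 𝔫 := J.basis (.inr (.inr i))

lemma Z_mem_center (k : Fin m) : J.basis (.inl k) ∈ LieAlgebra.center ℝ 𝔫 := by
  have h : J.basis (.inl k) ∈ (LieAlgebra.center ℝ 𝔫).toSubmodule := by
    rw [← J.span_Z]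
    exact Submodule.subset_span ⟨k, rfl⟩
  exact h

lemma lie_eq_zero_of_mem_center {c : 𝔫} (hc : c ∈ LieAlgebra.center ℝ 𝔫) (a : 𝔫) :
    ⁅a, c⁆ = 0 ∧ ⁅c, a⁆ = 0 := by
  have h : ⁅a, c⁆ = 0 := (LieModule.mem_maxTrivSubmodule ℝ 𝔫 𝔫 c).1 hc a
  refine ⟨h, ?_⟩
  rw [← lie_skew, h, neg_zero]

lemma lie_basis_mem_center (i j : Fin m ⊕ Fin d ⊕ Fin d) :
    ⁅J.basis i, J.basis j⁆ ∈ LieAlgebra.center ℝ 𝔫 := by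
  rcases i with i | i | i
  · rw [(lie_eq_zero_of_mem_center (J.Z_mem_center i) _).2]; exact zero_mem _
  · rcases j with j | j | j
    · rw [(lie_eq_zero_of_mem_center (J.Z_mem_center j) _).1]; exact zero_mem _
    · rw [J.lie_Y_Y]; exact zero_mem _
    · rw [← lie_skew]; exact neg_mem (J.lie_X_Y j i)
  · rcases j with j | j | j
    · rw [(lie_eq_zero_of_mem_center (J.Z_mem_center j) _).1]; exact zero_mem _
    · exact J.lie_X_Y i j
    · rw [J.lie_X_X]; exact zero_mem _

lemma lie_mem_center (J : JHBasis 𝔫 m d) (a b : 𝔫) : ⁅a, b⁆ ∈ LieAlgebra.center ℝ 𝔫 := by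
  have h : ((LieModule.toEnd ℝ 𝔫 𝔫 : 𝔫 →ₗ[ℝ] Module.End ℝ 𝔫).compr₂
      (LieAlgebra.center ℝ 𝔫).toSubmodule.mkQ) = 0 := by
    refine LinearMap.ext_basis J.basis J.basis fun i j => ?_
    simp only [LinearMap.compr₂_apply, LinearMap.zero_apply]
    exact (Submodule.Quotient.mk_eq_zero _).2 (J.lie_basis_mem_center i j)
  have h2 := LinearMap.congr_fun₂ h a b
  exact (Submodule.Quotient.mk_eq_zero _).1 h2

lemma lie_lie_eq_zero (J : JHBasis 𝔫 m d) (a b c : 𝔫) : ⁅a, ⁅b, c⁆⁆ = 0 ∧ ⁅⁅b, c⁆, a⁆ = 0 :=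
  lie_eq_zero_of_mem_center (J.lie_mem_center b c) a

/-- The linear functional on `𝔫` that vanishes on all `Y_i`, `X_i` and takes the values `lam k` at
`Z_k`; this identifies `ℝᵐ` with `𝔷(𝔫)*`. -/
def functional (lam : Fin m → ℝ) : Module.Dual ℝ 𝔫 :=
  J.basis.constr ℝ (Sum.elim lam fun _ => 0)

/-- The matrix `B(λ) = (λ[X_i, Y_j])`. -/
def B (lam : Fin m → ℝ) : Matrix (Fin d) (Fin d) ℝ :=
  Matrix.of fun i j => J.functional lam ⁅J.X i, J.Y j⁆

/-- The parametrizing set `Σ` of the dual, as a subset of `ℝᵐ ≅ 𝔷(𝔫)*`. -/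
def Sigma : Set (Fin m → ℝ) := {lam | (J.B lam).det ≠ 0}

/-- The Plancherel measure `|det B(λ)| dλ` on `Σ`. -/
def plancherelMeasure : Measure (Fin m → ℝ) :=
  (volume.restrict J.Sigma).withDensity fun lam => ENNReal.ofReal |(J.B lam).det|

/-- `E = ([-1/2,1/2]^m ∖ [-1/4,1/4]^m) ∩ Σ`. -/
def E : Set (Fin m → ℝ) :=
  (Set.Icc (fun _ => -(1 / 2 : ℝ)) (fun _ => (1 / 2 : ℝ)) \
    Set.Icc (fun _ => -(1 / 4 : ℝ)) (fun _ => (1 / 4 : ℝ))) ∩ J.Sigma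

/-- The weights `2` on `Z_k` and `Y_i`, `1` on `X_i`. -/
def weight : Fin m ⊕ Fin d ⊕ Fin d → ℝˣ
  | .inl _ => Units.mk0 2 two_ne_zero
  | .inr (.inl _) => Units.mk0 2 two_ne_zero
  | .inr (.inr _) => 1

/-- `Ad_A` as a linear map: `Z_k ↦ 2 Z_k`, `Y_i ↦ 2 Y_i`, `X_i ↦ X_i`. -/
def dilLin : 𝔫 ≃ₗ[ℝ] 𝔫 := J.basis.equiv (J.basis.unitsSMul weight) (Equiv.refl _)

lemma dilLin_basis (i : Fin m ⊕ Fin d ⊕ Fin d) :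
    J.dilLin (J.basis i) = (weight i : ℝ) • J.basis i := by
  simp [dilLin, Module.Basis.unitsSMul_apply, Units.smul_def]

lemma dilLin_of_mem_center {c : 𝔫} (hc : c ∈ LieAlgebra.center ℝ 𝔫) :
    J.dilLin c = (2 : ℝ) • c := by
  have hc' : c ∈ Submodule.span ℝ (Set.range fun k : Fin m => J.basis (.inl k)) := by
    rw [J.span_Z]; exact hc
  induction hc' using Submodule.span_induction with
  | mem x hx =>
    obtain ⟨k, rfl⟩ := hx
    simpa [weight] using J.dilLin_basis (.inl k)
  | zero => simp
  | add x y hx hy h1 h2 =>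
    rw [J.span_Z] at hx hy
    rw [map_add, h1 hx, h2 hy, smul_add]
  | smul a x hx h1 =>
    rw [J.span_Z] at hx
    rw [map_smul, h1 hx, smul_comm]

lemma dilLin_lie (a b : 𝔫) : J.dilLin ⁅a, b⁆ = ⁅J.dilLin a, J.dilLin b⁆ := by
  let β : 𝔫 →ₗ[ℝ] 𝔫 →ₗ[ℝ] 𝔫 := (LieModule.toEnd ℝ 𝔫 𝔫 : 𝔫 →ₗ[ℝ] Module.End ℝ 𝔫)
  have h : β.compr₂ (J.dilLin : 𝔫 →ₗ[ℝ] 𝔫) =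
      β.compl₁₂ (J.dilLin : 𝔫 →ₗ[ℝ] 𝔫) (J.dilLin : 𝔫 →ₗ[ℝ] 𝔫) := by
    refine LinearMap.ext_basis J.basis J.basis fun i j => ?_
    change J.dilLin ⁅J.basis i, J.basis j⁆ = ⁅J.dilLin (J.basis i), J.dilLin (J.basis j)⁆
    rw [J.dilLin_of_mem_center (J.lie_basis_mem_center i j), J.dilLin_basis, J.dilLin_basis]
    rcases i with i | i | i
    · simp [(lie_eq_zero_of_mem_center (J.Z_mem_center i) _).2]
    · rcases j with j | j | j
      · simp [(lie_eq_zero_of_mem_center (J.Z_mem_center j) _).1]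
      · simp [J.lie_Y_Y]
      · simp [weight]
    · rcases j with j | j | j
      · simp [(lie_eq_zero_of_mem_center (J.Z_mem_center j) _).1]
      · simp [weight]
      · simp [J.lie_X_X]
  exact LinearMap.congr_fun₂ h a b

end LieAlgebraPart

end JHBasis

section GroupPart

variable {𝔫 : Type*} [LieRing 𝔫] [LieAlgebra ℝ 𝔫] {m d : ℕ}

/-- The connected, simply connected nilpotent Lie group `N = exp 𝔫` of the (step-two) Lie algebra
`𝔫`: its elements are `exp v`, `v ∈ 𝔫`, and its law is the Baker–Campbell–Hausdorff formula. -/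
@[ext] structure NilGroup (J : JHBasis 𝔫 m d) where
  exp ::
  log : 𝔫

namespace NilGroup

variable {J : JHBasis 𝔫 m d}

instance : Mul (NilGroup J) :=
  ⟨fun a b => exp (a.log + b.log + (1 / 2 : ℝ) • ⁅a.log, b.log⁆)⟩
instance : One (NilGroup J) := ⟨exp 0⟩
instance : Inv (NilGroup J) := ⟨fun a => exp (-a.log)⟩

lemma log_mul (a b : NilGroup J) :
    (a * b).log = a.log + b.log + (1 / 2 : ℝ) • ⁅a.log, b.log⁆ := rfl
lemma log_one : (1 : NilGroup J).log = 0 := rfl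
lemma log_inv (a : NilGroup J) : a⁻¹.log = -a.log := rfl

instance : Group (NilGroup J) where
  mul_assoc a b c := by
    ext
    simp only [log_mul, lie_add, add_lie, lie_smul, smul_lie, (J.lie_lie_eq_zero _ _ _).1,
      (J.lie_lie_eq_zero _ _ _).2, smul_zero, add_zero, smul_add]
    abel
  one_mul a := by ext; simp [log_mul, log_one]
  mul_one a := by ext; simp [log_mul, log_one]
  inv_mul_cancel a := by ext; simp [log_mul, log_one, log_inv]

/-- The coordinates `(z, y, x)` of `exp (∑ z_k Z_k) exp (∑ y_i Y_i) exp (∑ x_i X_i)`. -/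
abbrev Coord (m d : ℕ) : Type := (Fin m → ℝ) × (Fin d → ℝ) × (Fin d → ℝ)

variable (J) in
/-- `exp (∑ z_k Z_k) exp (∑ y_i Y_i) exp (∑ x_i X_i)`. -/
def ofCoord (p : Coord m d) : NilGroup J :=
  exp (∑ k, p.1 k • J.Z k) * exp (∑ i, p.2.1 i • J.Y i) * exp (∑ i, p.2.2 i • J.X i)

/-- The bracket `[∑ x_i X_i, ∑ y_j Y_j]`, in coordinates with respect to the `Z_k`. -/
def brk (J : JHBasis 𝔫 m d) (x y : Fin d → ℝ) : Fin m → ℝ :=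
  fun k => J.basis.repr ⁅∑ i, x i • J.X i, ∑ j, y j • J.Y j⁆ (.inl k)

lemma repr_of_mem_center {c : 𝔫} (hc : c ∈ LieAlgebra.center ℝ 𝔫) (i : Fin d ⊕ Fin d) :
    J.basis.repr c (.inr i) = 0 := by
  have hc' : c ∈ Submodule.span ℝ (Set.range fun k : Fin m => J.basis (.inl k)) := by
    rw [J.span_Z]; exact hc
  induction hc' using Submodule.span_induction with
  | mem x hx =>
    obtain ⟨k, rfl⟩ := hx
    simp
  | zero => simp
  | add x y hx hy h1 h2 =>
    rw [J.span_Z] at hx hy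
    simp [h1 hx, h2 hy]
  | smul a x hx h1 =>
    rw [J.span_Z] at hx
    simp [h1 hx]

lemma lie_sum_Y_X (x y : Fin d → ℝ) :
    ⁅∑ i, y i • J.Y i, ∑ i, x i • J.X i⁆ = -∑ k, brk J x y k • J.Z k := by
  rw [← lie_skew]
  congr 1
  apply J.basis.repr.injective
  ext i
  rcases i with i | i
  · simp [brk, JHBasis.Z, Finsupp.single_apply]
  · rw [repr_of_mem_center (J.lie_mem_center _ _)]
    simp [JHBasis.Z]

lemma sum_Z_mem_center (z : Fin m → ℝ) : ∑ k, z k • J.Z k ∈ LieAlgebra.center ℝ 𝔫 :=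
  sum_mem fun k _ => (LieAlgebra.center ℝ 𝔫).smul_mem _ (J.Z_mem_center k)

lemma log_ofCoord (p : Coord m d) :
    (ofCoord J p).log = ∑ k, (p.1 k - (1 / 2) * brk J p.2.2 p.2.1 k) • J.Z k
      + ∑ i, p.2.1 i • J.Y i + ∑ i, p.2.2 i • J.X i := by
  have h := fun a => (JHBasis.lie_eq_zero_of_mem_center (sum_Z_mem_center (J := J) p.1) a).2
  simp only [ofCoord, log_mul, h, smul_zero, add_zero, add_lie, zero_add, lie_sum_Y_X, sub_smul,
    Finset.sum_sub_distrib, mul_smul, Finset.smul_sum, smul_neg]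
  abel

variable (J) in
/-- The global coordinates `(z, y, x)` on `N`. -/
def coord : NilGroup J ≃ Coord m d where
  toFun a :=
    (fun k => J.basis.repr a.log (.inl k) + (1 / 2) * brk J
        (fun i => J.basis.repr a.log (.inr (.inr i)))
        (fun i => J.basis.repr a.log (.inr (.inl i))) k,
      fun i => J.basis.repr a.log (.inr (.inl i)),
      fun i => J.basis.repr a.log (.inr (.inr i)))
  invFun := ofCoord J
  left_inv a := by
    ext
    rw [log_ofCoord]
    apply J.basis.repr.injective
    ext i
    rcases i with i | i | i <;> simp [JHBasis.X, JHBasis.Y, JHBasis.Z, Finsupp.single_apply]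
  right_inv p := by
    have hx : (fun i => J.basis.repr (ofCoord J p).log (.inr (.inr i))) = p.2.2 := by
      ext i
      simp [log_ofCoord, JHBasis.X, JHBasis.Y, JHBasis.Z, Finsupp.single_apply]
    have hy : (fun i => J.basis.repr (ofCoord J p).log (.inr (.inl i))) = p.2.1 := by
      ext i
      simp [log_ofCoord, JHBasis.X, JHBasis.Y, JHBasis.Z, Finsupp.single_apply]
    simp only [hx, hy]
    refine Prod.ext ?_ rfl
    ext k
    simp [log_ofCoord, JHBasis.X, JHBasis.Y, JHBasis.Z, Finsupp.single_apply]

/-- The coordinates are a homeomorphism for the manifold topology of `N`, so this is the Borel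
σ-algebra. -/
instance : MeasurableSpace (NilGroup J) := MeasurableSpace.comap (coord J) inferInstance

variable (J) in
def coordM : NilGroup J ≃ᵐ Coord m d where
  toEquiv := coord J
  measurable_toFun := comap_measurable _
  measurable_invFun := by
    rintro s ⟨t, ht, rfl⟩
    rw [← Set.preimage_comp]
    simpa using ht

variable (J) in
/-- The Haar measure of `N`: Lebesgue measure in the coordinates `(z, y, x)`. -/
def haar : Measure (NilGroup J) := Measure.map (coordM J).symm volume

lemma brk_add_left (x x' y : Fin d → ℝ) : brk J (x + x') y = brk J x y + brk J x' y := by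
  ext k
  simp [brk, add_smul, Finset.sum_add_distrib]

lemma brk_add_right (x y y' : Fin d → ℝ) : brk J x (y + y') = brk J x y + brk J x y' := by
  ext k
  simp [brk, add_smul, Finset.sum_add_distrib]

lemma lie_log_ofCoord (p q : Coord m d) :
    ⁅(ofCoord J p).log, (ofCoord J q).log⁆ =
      ∑ k, (brk J p.2.2 q.2.1 k - brk J q.2.2 p.2.1 k) • J.Z k := by
  have h := fun (z : Fin m → ℝ) a =>
    (JHBasis.lie_eq_zero_of_mem_center (sum_Z_mem_center (J := J) z) a).1
  have h' := fun (z : Fin m → ℝ) a =>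
    (JHBasis.lie_eq_zero_of_mem_center (sum_Z_mem_center (J := J) z) a).2
  have hX : ∀ x x' : Fin d → ℝ, ⁅∑ i, x i • J.X i, ∑ i, x' i • J.X i⁆ = 0 := fun x x' => by
    simp [sum_lie, lie_sum, JHBasis.X, J.lie_X_X]
  have hY : ∀ x x' : Fin d → ℝ, ⁅∑ i, x i • J.Y i, ∑ i, x' i • J.Y i⁆ = 0 := fun x x' => by
    simp [sum_lie, lie_sum, JHBasis.Y, J.lie_Y_Y]
  have hXY : ∀ x y : Fin d → ℝ,
      ⁅∑ i, x i • J.X i, ∑ i, y i • J.Y i⁆ = ∑ k, brk J x y k • J.Z k := fun x y => by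
    rw [← lie_skew, lie_sum_Y_X, neg_neg]
  simp only [log_ofCoord, lie_add, add_lie, h, h', hX, hY, hXY, lie_sum_Y_X, zero_add, add_zero]
  simp only [sub_smul, Finset.sum_sub_distrib]
  abel

lemma ofCoord_mul (p q : Coord m d) : ofCoord J p * ofCoord J q =
    ofCoord J (p.1 + q.1 + brk J p.2.2 q.2.1, p.2.1 + q.2.1, p.2.2 + q.2.2) := by
  ext
  rw [log_mul, lie_log_ofCoord]
  simp only [log_ofCoord, Pi.add_apply, brk_add_left, brk_add_right, add_smul, sub_smul,
    Finset.sum_add_distrib, Finset.sum_sub_distrib, mul_add, smul_sub, mul_smul,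
    ← Finset.smul_sum]
  module

lemma coord_mul (a b : NilGroup J) : coord J (a * b) =
    ((coord J a).1 + (coord J b).1 + brk J (coord J a).2.2 (coord J b).2.1,
      (coord J a).2.1 + (coord J b).2.1, (coord J a).2.2 + (coord J b).2.2) := by
  apply (coord J).symm.injective
  rw [Equiv.symm_apply_apply]
  change a * b = ofCoord J _
  rw [← ofCoord_mul]
  exact congrArg₂ (· * ·) ((coord J).symm_apply_apply a).symm ((coord J).symm_apply_apply b).symm

lemma continuous_brk (x : Fin d → ℝ) : Continuous (brk J x) := by
  have h : brk J x = fun y k => ∑ j, y j * brk J x (Pi.single j 1) k := by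
    ext y k
    simp [brk, lie_sum, Pi.single_apply, Finsupp.finsetSum_apply]
  rw [h]
  fun_prop

instance : SFinite (haar J) := by unfold haar; infer_instance

lemma measurePreserving_coordM : MeasurePreserving (coordM J) (haar J) volume :=
  ⟨(coordM J).measurable, by rw [haar, MeasurableEquiv.map_map_symm]⟩

/-- Left translations preserve the Haar measure. -/
lemma measurePreserving_mul_left (a : NilGroup J) :
    MeasurePreserving (fun b => a * b) (haar J) (haar J) := by
  have h1 : MeasurePreserving (fun q : (Fin d → ℝ) × (Fin d → ℝ) =>
      ((coord J a).2.1 + q.1, (coord J a).2.2 + q.2)) volume volume :=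
    (measurePreserving_add_left volume (coord J a).2.1).prod
      (measurePreserving_add_left volume (coord J a).2.2)
  have h2 : MeasurePreserving (fun p : ((Fin d → ℝ) × (Fin d → ℝ)) × (Fin m → ℝ) =>
      (((coord J a).2.1 + p.1.1, (coord J a).2.2 + p.1.2),
        ((coord J a).1 + brk J (coord J a).2.2 p.1.1) + p.2)) (volume.prod volume)
        (volume.prod volume) := by
    refine h1.skew_product (g := fun (q : (Fin d → ℝ) × (Fin d → ℝ)) (z : Fin m → ℝ) =>
      ((coord J a).1 + brk J (coord J a).2.2 q.1) + z) ?_ ?_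
    · have := (continuous_brk (J := J) (coord J a).2.2)
      exact (by fun_prop : Continuous _).measurable
    · exact Filter.Eventually.of_forall fun q =>
        (measurePreserving_add_left volume _).map_eq
  have h3 := (Measure.measurePreserving_swap (μ := (volume : Measure ((Fin d → ℝ) × (Fin d → ℝ))))
    (ν := (volume : Measure (Fin m → ℝ)))).comp (h2.comp Measure.measurePreserving_swap)
  have h4 := ((measurePreserving_coordM (J := J)).symm (coordM J)).comp
    (h3.comp (measurePreserving_coordM (J := J)))
  convert h4 using 1
  ext b : 1
  apply (coordM J).injective
  simp only [Function.comp_apply, MeasurableEquiv.apply_symm_apply]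
  change coord J (a * b) = _
  rw [coord_mul]
  change _ = ((coord J a).1 + brk J (coord J a).2.2 (coord J b).2.1 + (coord J b).1,
    (coord J a).2.1 + (coord J b).2.1, (coord J a).2.2 + (coord J b).2.2)
  rw [add_right_comm]

/-- `A` as an automorphism of `N`. -/
def dil (J : JHBasis 𝔫 m d) : MulAut (NilGroup J) where
  toFun a := exp (J.dilLin a.log)
  invFun a := exp (J.dilLin.symm a.log)
  left_inv a := by simp
  right_inv a := by simp
  map_mul' a b := by
    ext
    simp [log_mul, J.dilLin_lie]

/-- The set `Γ = exp(∑ ℤ Z_k) exp(∑ ℤ Y_i) exp(∑ ℤ X_i)`. -/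
def Gam (J : JHBasis 𝔫 m d) : Set (NilGroup J) :=
  {g | ∃ (a : Fin m → ℤ) (b c : Fin d → ℤ),
    g = exp (∑ k, (a k : ℝ) • J.Z k) * exp (∑ i, (b i : ℝ) • J.Y i) *
      exp (∑ i, (c i : ℝ) • J.X i)}

lemma dil_ofCoord (p : Coord m d) :
    dil J (ofCoord J p) = ofCoord J ((2 : ℝ) • p.1, (2 : ℝ) • p.2.1, p.2.2) := by
  have h : ∀ v, dil J (exp v) = exp (J.dilLin v) := fun v => rfl
  have h1 : ∀ i, J.dilLin (J.Z i) = (2 : ℝ) • J.Z i := fun i => J.dilLin_basis (.inl i)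
  have h2 : ∀ i, J.dilLin (J.Y i) = (2 : ℝ) • J.Y i := fun i => J.dilLin_basis (.inr (.inl i))
  have h3 : ∀ i, J.dilLin (J.X i) = J.X i := fun i => by
    have := J.dilLin_basis (.inr (.inr i))
    simpa [JHBasis.weight, JHBasis.X] using this
  rw [ofCoord, map_mul, map_mul, h, h, h]
  simp only [ofCoord, map_sum, map_smul, h1, h2, h3, Pi.smul_apply, smul_smul, smul_eq_mul,
    mul_comm]

lemma coord_dil (a : NilGroup J) :
    coord J (dil J a) = ((2 : ℝ) • (coord J a).1, (2 : ℝ) • (coord J a).2.1, (coord J a).2.2) := by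
  apply (coord J).symm.injective
  rw [Equiv.symm_apply_apply]
  change _ = ofCoord J _
  rw [← dil_ofCoord]
  exact congrArg (dil J) ((coord J).symm_apply_apply a).symm

lemma coord_dil_zpow (j : ℤ) (a : NilGroup J) : coord J ((dil J ^ j) a) =
    ((2 : ℝ) ^ j • (coord J a).1, (2 : ℝ) ^ j • (coord J a).2.1, (coord J a).2.2) := by
  induction j using Int.induction_on generalizing a with
  | zero => simp
  | succ i ih =>
    rw [zpow_add_one, MulAut.mul_apply, ih, coord_dil, zpow_add_one₀ two_ne_zero]
    simp [smul_smul]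
  | pred i ih =>
    have h := coord_dil ((dil J)⁻¹ a)
    rw [MulAut.apply_inv_self] at h
    rw [zpow_sub_one, MulAut.mul_apply, ih, h, zpow_sub_one₀ two_ne_zero]
    simp [smul_smul]

/-- `A^j` multiplies the Haar measure by a constant. -/
lemma map_dil_zpow_haar (j : ℤ) : ∃ c : ℝ≥0∞, c ≠ ∞ ∧
    Measurable (dil J ^ j : MulAut (NilGroup J)) ∧
    Measure.map (dil J ^ j : MulAut (NilGroup J)) (haar J) = c • haar J := by
  have h2 : ((2 : ℝ) ^ j) ≠ 0 := zpow_ne_zero _ two_ne_zero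
  let T : Coord m d → Coord m d := Prod.map ((2 : ℝ) ^ j • ·) (Prod.map ((2 : ℝ) ^ j • ·) id)
  have hT : Measurable T := by fun_prop
  have hmT : ∃ c : ℝ≥0∞, c ≠ ∞ ∧ Measure.map T volume = c • volume := by
    refine ⟨ENNReal.ofReal |(((2 : ℝ) ^ j) ^ Module.finrank ℝ (Fin m → ℝ))⁻¹| *
      ENNReal.ofReal |(((2 : ℝ) ^ j) ^ Module.finrank ℝ (Fin d → ℝ))⁻¹|,
      ENNReal.mul_ne_top ENNReal.ofReal_ne_top ENNReal.ofReal_ne_top, ?_⟩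
    rw [Measure.volume_eq_prod, ← Measure.map_prod_map _ _ (by fun_prop) (by fun_prop),
      Measure.volume_eq_prod, ← Measure.map_prod_map _ _ (by fun_prop) (by fun_prop),
      Measure.map_addHaar_smul _ h2, Measure.map_addHaar_smul _ h2, Measure.map_id,
      Measure.prod_smul_left, Measure.prod_smul_left, Measure.prod_smul_right, smul_smul]
  obtain ⟨c, hc, hmT⟩ := hmT
  have heq : (dil J ^ j : MulAut (NilGroup J)) = (coordM J).symm ∘ T ∘ coordM J := by
    ext a : 1
    apply (coordM J).injective
    simp only [Function.comp_apply, MeasurableEquiv.apply_symm_apply]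
    exact coord_dil_zpow j a
  have hm : Measurable (dil J ^ j : MulAut (NilGroup J)) := by
    rw [heq]
    exact (coordM J).symm.measurable.comp (hT.comp (coordM J).measurable)
  refine ⟨c, hc, hm, ?_⟩
  rw [heq, ← Measure.map_map (coordM J).symm.measurable (hT.comp (coordM J).measurable),
    ← Measure.map_map hT (coordM J).measurable, measurePreserving_coordM.map_eq, hmT,
    Measure.map_smul, haar]

end NilGroup

end GroupPart

section Operators

open NilGroup

variable {𝔫 : Type*} [LieRing 𝔫] [LieAlgebra ℝ 𝔫] {m d : ℕ} (J : JHBasis 𝔫 m d)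

/-- `L²(N)`. -/
abbrev L2N : Type _ := Lp ℂ 2 (haar J)

/-- `L²(ℝᵈ)`. -/
abbrev L2R (d : ℕ) : Type := Lp ℂ 2 (volume : Measure (Fin d → ℝ))

/-- `∫_Σ^⊕ L²(ℝᵈ) ⊗ L²(ℝᵈ) |det B(λ)| dλ`: square-integrable fields of Hilbert–Schmidt operators on
`L²(ℝᵈ)`, each operator given by its integral kernel `(t, s) ↦ K(λ, t, s)`. -/
abbrev L2K : Type :=
  Lp ℂ 2 (J.plancherelMeasure.prod (volume : Measure ((Fin d → ℝ) × (Fin d → ℝ))))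

instance : SFinite J.plancherelMeasure := by
  unfold JHBasis.plancherelMeasure
  infer_instance

variable {J}

/-- The left regular representation `(L(a) f)(b) = f(a⁻¹ b)`. -/
def L (a : NilGroup J) : L2N J →ₗᵢ[ℂ] L2N J :=
  Lp.compMeasurePreservingₗᵢ ℂ (fun b => a⁻¹ * b) (measurePreserving_mul_left a⁻¹)

lemma memLp_comp_dil (j : ℤ) (f : L2N J) :
    MemLp (fun a => f ((dil J ^ (-j)) a)) 2 (haar J) := by
  obtain ⟨c, hc, hm, hmap⟩ := map_dil_zpow_haar (J := J) (-j)
  have h : MemLp f 2 (Measure.map (dil J ^ (-j) : MulAut (NilGroup J)) (haar J)) := by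
    rw [hmap]
    exact (Lp.memLp f).smul_measure hc
  exact h.comp_of_map hm.aemeasurable

lemma quasiMeasurePreserving_dil (j : ℤ) :
    Measure.QuasiMeasurePreserving (dil J ^ j : MulAut (NilGroup J)) (haar J) (haar J) := by
  obtain ⟨c, hc, hm, hmap⟩ := map_dil_zpow_haar (J := J) j
  refine ⟨hm, ?_⟩
  rw [hmap]
  exact Measure.smul_absolutelyContinuous

/-- The normalizing factor `det(Ad_A)^{-j/2} = 2^{-j(n-d)/2}`, where `n - d = m + d`. -/
def dilFactor (m d : ℕ) (j : ℤ) : ℂ := (((2 : ℝ) ^ (-((j : ℝ) * ((m : ℝ) + d) / 2)) : ℝ) : ℂ)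

/-- The dilation operator `(D_{A^j} f)(a) = 2^{-j(n-d)/2} f(A^{-j} a)`. -/
def D (j : ℤ) : L2N J →ₗ[ℂ] L2N J where
  toFun f := ((memLp_comp_dil j f).const_mul (dilFactor m d j)).toLp
    (fun a => dilFactor m d j * f ((dil J ^ (-j)) a))
  map_add' f g := by
    rw [← MemLp.toLp_add]
    refine MemLp.toLp_congr _ _ ?_
    filter_upwards [(quasiMeasurePreserving_dil (J := J) (-j)).ae (Lp.coeFn_add f g)] with a ha
    simp only [Pi.add_apply] at ha ⊢
    rw [ha, mul_add]
  map_smul' c f := by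
    rw [RingHom.id_apply, ← MemLp.toLp_const_smul]
    refine MemLp.toLp_congr _ _ ?_
    filter_upwards [(quasiMeasurePreserving_dil (J := J) (-j)).ae (Lp.coeFn_smul c f)] with a ha
    simp only [Pi.smul_apply, smul_eq_mul] at ha ⊢
    rw [ha]
    ring

/-- The phase `e^{2πi⟨λ,z⟩} e^{-2πi⟨t,B(λ)y⟩}`. -/
def phase (lam : Fin m → ℝ) (p : Coord m d) (t : Fin d → ℝ) (J : JHBasis 𝔫 m d) : ℂ :=
  Complex.exp (((2 * Real.pi * (lam ⬝ᵥ p.1) : ℝ) : ℂ) * Complex.I) *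
    Complex.exp (((-(2 * Real.pi * (t ⬝ᵥ (J.B lam).mulVec p.2.1)) : ℝ) : ℂ) * Complex.I)

lemma norm_phase (lam : Fin m → ℝ) (p : Coord m d) (t : Fin d → ℝ) :
    ‖phase lam p t J‖ = 1 := by
  rw [phase, norm_mul, Complex.norm_exp_ofReal_mul_I, Complex.norm_exp_ofReal_mul_I, one_mul]

lemma continuous_phase (lam : Fin m → ℝ) :
    Continuous fun q : Coord m d × (Fin d → ℝ) => phase lam q.1 q.2 J := by
  unfold phase
  simp only [dotProduct, Matrix.mulVec]
  fun_prop

/-- The function `t ↦ e^{2πi⟨λ,z⟩} e^{-2πi⟨t,B(λ)y⟩} φ(t - x)`. -/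
def repFun (lam : Fin m → ℝ) (a : NilGroup J) (φ : (Fin d → ℝ) → ℂ) (t : Fin d → ℝ) : ℂ :=
  phase lam (coord J a) t J * φ (t - (coord J a).2.2)

lemma memLp_repFun (lam : Fin m → ℝ) (a : NilGroup J) {φ : (Fin d → ℝ) → ℂ}
    (hφ : MemLp φ 2 volume) : MemLp (repFun lam a φ) 2 volume := by
  have h : MemLp (fun t => φ (t - (coord J a).2.2)) 2 volume :=
    hφ.comp_measurePreserving (measurePreserving_sub_right volume _)
  refine h.congr_norm ?_ (Filter.Eventually.of_forall fun t => ?_)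
  · refine AEStronglyMeasurable.mul ?_ h.1
    have := (continuous_phase (J := J) lam).comp (Continuous.prodMk_right (coord J a))
    exact this.aestronglyMeasurable
  · simp [repFun, norm_phase]

lemma ae_sub {P : (Fin d → ℝ) → Prop} (h : ∀ᵐ t, P t) (x : Fin d → ℝ) : ∀ᵐ t, P (t - x) :=
  (measurePreserving_sub_right volume x).quasiMeasurePreserving.ae h

/-- The irreducible unitary representation `π_λ` of `N` in `L²(ℝᵈ)` with central character
`e^{2πi⟨λ,·⟩}`: for `a = exp(∑ z_k Z_k) exp(∑ y_i Y_i) exp(∑ x_i X_i)`,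
`(π_λ(a) φ)(t) = e^{2πi⟨λ,z⟩} e^{-2πi⟨t,B(λ)y⟩} φ(t - x)`. -/
def rep (lam : Fin m → ℝ) (a : NilGroup J) : L2R d →ₗ[ℂ] L2R d where
  toFun φ := (memLp_repFun lam a (Lp.memLp φ)).toLp (repFun lam a φ)
  map_add' φ ψ := by
    rw [← MemLp.toLp_add]
    refine MemLp.toLp_congr _ _ ?_
    filter_upwards [ae_sub (Lp.coeFn_add φ ψ) (coord J a).2.2] with t ht
    simp only [Pi.add_apply, repFun] at ht ⊢
    rw [ht, mul_add]
  map_smul' c φ := by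
    rw [RingHom.id_apply, ← MemLp.toLp_const_smul]
    refine MemLp.toLp_congr _ _ ?_
    filter_upwards [ae_sub (Lp.coeFn_smul c φ) (coord J a).2.2] with t ht
    simp only [Pi.smul_apply, repFun, smul_eq_mul] at ht ⊢
    rw [ht]
    ring

lemma dotProduct_brk (lam : Fin m → ℝ) (x y : Fin d → ℝ) :
    lam ⬝ᵥ brk J x y = x ⬝ᵥ (J.B lam).mulVec y := by
  have h1 : J.functional lam (∑ k, brk J x y k • J.Z k) = lam ⬝ᵥ brk J x y := by
    simp [dotProduct, JHBasis.functional, JHBasis.Z, mul_comm]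
  have h2 : ∑ k, brk J x y k • J.Z k = ⁅∑ i, x i • J.X i, ∑ j, y j • J.Y j⁆ := by
    rw [← lie_skew, lie_sum_Y_X, neg_neg]
  rw [← h1, h2]
  simp [sum_lie, lie_sum, dotProduct, Matrix.mulVec, JHBasis.B, Finset.mul_sum, mul_comm,
    mul_left_comm]
  exact Finset.sum_comm

lemma phase_mul (lam : Fin m → ℝ) (a b : NilGroup J) (t : Fin d → ℝ) :
    phase lam (coord J (a * b)) t J =
      phase lam (coord J a) t J * phase lam (coord J b) (t - (coord J a).2.2) J := by
  rw [coord_mul]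
  simp only [phase, ← Complex.exp_add, dotProduct_add, Matrix.mulVec_add, sub_dotProduct,
    dotProduct_brk]
  congr 1
  push_cast
  ring

/-- `π_λ` is a homomorphism. -/
lemma rep_mul (lam : Fin m → ℝ) (a b : NilGroup J) :
    rep lam (a * b) = rep lam a ∘ₗ rep lam b := by
  ext1 φ
  change (memLp_repFun lam (a * b) (Lp.memLp φ)).toLp (repFun lam (a * b) φ) =
    (memLp_repFun lam a (Lp.memLp (rep lam b φ))).toLp (repFun lam a (rep lam b φ))
  refine MemLp.toLp_congr _ _ ?_
  have h : ∀ᵐ t, rep lam b φ t = repFun lam b φ t :=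
    (memLp_repFun lam b (Lp.memLp φ)).coeFn_toLp
  filter_upwards [ae_sub h (coord J a).2.2] with t ht
  simp only [repFun] at ht ⊢
  rw [ht, phase_mul, coord_mul, mul_assoc, sub_sub]

lemma norm_rep (lam : Fin m → ℝ) (a : NilGroup J) (φ : L2R d) : ‖rep lam a φ‖ = ‖φ‖ := by
  change ‖(memLp_repFun lam a (Lp.memLp φ)).toLp (repFun lam a φ)‖ = _
  rw [Lp.norm_toLp, Lp.norm_def]
  congr 1
  have h := eLpNorm_comp_measurePreserving (p := 2) (Lp.aestronglyMeasurable φ)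
    (measurePreserving_sub_right volume (coord J a).2.2)
  rw [← h]
  exact eLpNorm_congr_norm_ae (Filter.Eventually.of_forall fun t => by
    simp [repFun, norm_phase])

lemma aestronglyMeasurable_coeff (lam : Fin m → ℝ) (φ ψ : L2R d) :
    AEStronglyMeasurable (fun a : NilGroup J => inner ℂ ψ (rep lam a φ)) (haar J) := by
  have h : ∀ a : NilGroup J, inner ℂ ψ (rep lam a φ) =
      ∫ t, phase lam (coord J a) t J * φ (t - (coord J a).2.2) * conj (ψ t) := fun a => by
    rw [L2.inner_def]
    refine integral_congr_ae ?_
    filter_upwards [(memLp_repFun lam a (Lp.memLp φ)).coeFn_toLp] with t ht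
    change inner ℂ (ψ t) ((memLp_repFun lam a (Lp.memLp φ)).toLp (repFun lam a φ) t) = _
    rw [ht]
    simp [repFun]
  simp_rw [h]
  have hc : Measurable (coord J) := (coordM J).measurable
  refine StronglyMeasurable.aestronglyMeasurable (StronglyMeasurable.integral_prod_right ?_)
  refine StronglyMeasurable.mul (StronglyMeasurable.mul ?_ ?_) ?_
  · exact ((continuous_phase (J := J) lam).measurable.comp
      (hc.prodMap measurable_id)).stronglyMeasurable
  · have hsub : Measurable fun q : NilGroup J × (Fin d → ℝ) => q.2 - (coord J q.1).2.2 :=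
      measurable_snd.sub (measurable_snd.comp (measurable_snd.comp (hc.comp measurable_fst)))
    exact (Lp.stronglyMeasurable φ).comp_measurable hsub
  · have hψ : StronglyMeasurable fun t => conj (ψ t) :=
      RCLike.continuous_conj.comp_stronglyMeasurable (Lp.stronglyMeasurable ψ)
    exact hψ.comp_measurable (measurable_snd (α := NilGroup J))

lemma integrable_mul_coeff (lam : Fin m → ℝ) (φ ψ : L2R d) {f : NilGroup J → ℂ}
    (hf : Integrable f (haar J)) :
    Integrable (fun a : NilGroup J => f a * inner ℂ ψ (rep lam a φ)) (haar J) := by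
  refine hf.mul_bdd (c := ‖ψ‖ * ‖φ‖) (aestronglyMeasurable_coeff lam φ ψ)
    (Filter.Eventually.of_forall fun a => ?_)
  rw [← norm_rep lam a φ]
  exact norm_inner_le_norm _ _

lemma integrable_kernel (K : L2K J) : ∀ᵐ lam ∂J.plancherelMeasure, ∀ φ ψ : L2R d,
    Integrable fun q : (Fin d → ℝ) × (Fin d → ℝ) => K (lam, q) * φ q.2 * conj (ψ q.1) := by
  have h1 : Integrable (fun p => ‖K p‖ ^ 2)
      (J.plancherelMeasure.prod (volume : Measure ((Fin d → ℝ) × (Fin d → ℝ)))) :=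
    (memLp_two_iff_integrable_sq_norm (Lp.aestronglyMeasurable K)).1 (Lp.memLp K)
  filter_upwards [h1.prod_right_ae] with lam hlam φ ψ
  have hK : StronglyMeasurable fun q : (Fin d → ℝ) × (Fin d → ℝ) => K (lam, q) :=
    (Lp.stronglyMeasurable K).comp_measurable measurable_prodMk_left
  have hK2 : MemLp (fun q : (Fin d → ℝ) × (Fin d → ℝ) => K (lam, q)) 2 volume :=
    (memLp_two_iff_integrable_sq_norm hK.aestronglyMeasurable).2 hlam
  have hsq : ∀ χ : L2R d, Integrable (fun t => ‖χ t‖ ^ 2) volume := fun χ =>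
    (memLp_two_iff_integrable_sq_norm (Lp.aestronglyMeasurable χ)).1 (Lp.memLp χ)
  have hs : StronglyMeasurable fun q : (Fin d → ℝ) × (Fin d → ℝ) => φ q.2 * conj (ψ q.1) :=
    ((Lp.stronglyMeasurable φ).comp_measurable measurable_snd).mul
      ((RCLike.continuous_conj.comp_stronglyMeasurable (Lp.stronglyMeasurable ψ)).comp_measurable
        measurable_fst)
  have hs2 : MemLp (fun q : (Fin d → ℝ) × (Fin d → ℝ) => φ q.2 * conj (ψ q.1)) 2 volume := by
    refine (memLp_two_iff_integrable_sq_norm hs.aestronglyMeasurable).2 ?_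
    refine ((hsq ψ).mul_prod (hsq φ)).congr (Filter.Eventually.of_forall fun q => ?_)
    simp [mul_pow, mul_comm]
  refine (hK2.integrable_mul hs2).congr (Filter.Eventually.of_forall fun q => ?_)
  simp [mul_assoc]

variable (J)

/-- The graph of the Fourier transform on `L¹(N) ∩ L²(N)`. The pair `(f, K)` belongs to it if, for
almost every `λ`, the operator `ℱf(λ) = ∫_N f(a) π_λ(a) da`, defined weakly by
`⟨ℱf(λ) φ, ψ⟩ = ∫_N f(a) ⟨π_λ(a) φ, ψ⟩ da`, is the operator with integral kernel `K(λ, ·, ·)`.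
(Mathlib's inner product is linear in its second argument.) -/
def fourierGraph : Submodule ℂ (L2N J × L2K J) where
  carrier := {p | Integrable p.1 (haar J) ∧ ∀ᵐ lam ∂J.plancherelMeasure, ∀ φ ψ : L2R d,
    ∫ q : (Fin d → ℝ) × (Fin d → ℝ), p.2 (lam, q) * φ q.2 * conj (ψ q.1) =
      ∫ a, p.1 a * inner ℂ ψ (rep lam a φ) ∂haar J}
  zero_mem' := by
    refine ⟨(integrable_congr (Lp.coeFn_zero ℂ 2 (haar J))).2 (integrable_zero _ _ _), ?_⟩
    filter_upwards [Measure.ae_ae_of_ae_prod (Lp.coeFn_zero ℂ 2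
      (J.plancherelMeasure.prod (volume : Measure ((Fin d → ℝ) × (Fin d → ℝ)))))] with lam h φ ψ
    rw [integral_eq_zero_of_ae, integral_eq_zero_of_ae]
    · filter_upwards [Lp.coeFn_zero ℂ 2 (haar J)] with a ha
      simp only [Prod.fst_zero, ha, Pi.zero_apply, zero_mul]
    · filter_upwards [h] with q hq
      simp only [Prod.snd_zero, hq, Pi.zero_apply, zero_mul]
  add_mem' := by
    rintro ⟨f, K⟩ ⟨g, M⟩ ⟨hf, hK⟩ ⟨hg, hM⟩
    refine ⟨(integrable_congr (Lp.coeFn_add f g)).2 (hf.add hg), ?_⟩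
    filter_upwards [Measure.ae_ae_of_ae_prod (Lp.coeFn_add K M), hK, hM, integrable_kernel K,
      integrable_kernel M] with lam h h1 h2 h3 h4 φ ψ
    have e1 : ∫ q : (Fin d → ℝ) × (Fin d → ℝ), (K + M) (lam, q) * φ q.2 * conj (ψ q.1) =
        ∫ q : (Fin d → ℝ) × (Fin d → ℝ), (K (lam, q) * φ q.2 * conj (ψ q.1) +
          M (lam, q) * φ q.2 * conj (ψ q.1)) := by
      refine integral_congr_ae ?_
      filter_upwards [h] with q hq
      rw [hq, Pi.add_apply]
      ring
    have e2 : ∫ a, (f + g) a * inner ℂ ψ (rep lam a φ) ∂haar J =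
        ∫ a, (f a * inner ℂ ψ (rep lam a φ) + g a * inner ℂ ψ (rep lam a φ)) ∂haar J := by
      refine integral_congr_ae ?_
      filter_upwards [Lp.coeFn_add f g] with a ha
      rw [ha, Pi.add_apply, add_mul]
    change ∫ q : (Fin d → ℝ) × (Fin d → ℝ), (K + M) (lam, q) * φ q.2 * conj (ψ q.1) =
      ∫ a, (f + g) a * inner ℂ ψ (rep lam a φ) ∂haar J
    rw [e1, e2, integral_add (h3 φ ψ) (h4 φ ψ),
      integral_add (integrable_mul_coeff lam φ ψ hf) (integrable_mul_coeff lam φ ψ hg)]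
    exact congrArg₂ (· + ·) (h1 φ ψ) (h2 φ ψ)
  smul_mem' := by
    rintro c ⟨f, K⟩ ⟨hf, hK⟩
    refine ⟨(integrable_congr (Lp.coeFn_smul c f)).2 (hf.smul c), ?_⟩
    filter_upwards [Measure.ae_ae_of_ae_prod (Lp.coeFn_smul c K), hK] with lam h h1 φ ψ
    have e1 : ∫ q : (Fin d → ℝ) × (Fin d → ℝ), (c • K) (lam, q) * φ q.2 * conj (ψ q.1) =
        ∫ q : (Fin d → ℝ) × (Fin d → ℝ), c * (K (lam, q) * φ q.2 * conj (ψ q.1)) := by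
      refine integral_congr_ae ?_
      filter_upwards [h] with q hq
      rw [hq, Pi.smul_apply, smul_eq_mul]
      ring
    have e2 : ∫ a, (c • f) a * inner ℂ ψ (rep lam a φ) ∂haar J =
        ∫ a, c * (f a * inner ℂ ψ (rep lam a φ)) ∂haar J := by
      refine integral_congr_ae ?_
      filter_upwards [Lp.coeFn_smul c f] with a ha
      rw [ha, Pi.smul_apply, smul_eq_mul, mul_assoc]
    change ∫ q : (Fin d → ℝ) × (Fin d → ℝ), (c • K) (lam, q) * φ q.2 * conj (ψ q.1) =
      ∫ a, (c • f) a * inner ℂ ψ (rep lam a φ) ∂haar J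
    rw [e1, e2, integral_const_mul, integral_const_mul]
    exact congrArg (c * ·) (h1 φ ψ)

/-- The graph of the Plancherel transform `𝒫`, the extension by continuity of the Fourier transform
from `L¹(N) ∩ L²(N)` to `L²(N)`. -/
def plancherelGraph : Submodule ℂ (L2N J × L2K J) := (fourierGraph J).topologicalClosure

/-- `∫_S^⊕ (L²(ℝᵈ) ⊗ u) |det B(λ)| dλ`, as a space of fields over `Σ` that vanish off `S`. The
rank-one operator `φ ⊗ u : v ↦ ⟨v, u⟩ φ` has the integral kernel `φ(t) conj (u(s))`. -/
def fiberSpace (S : Set (Fin m → ℝ)) (u : L2R d) : Submodule ℂ (L2K J) where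
  carrier := {K | ∃ φ : (Fin m → ℝ) × (Fin d → ℝ) → ℂ,
    MemLp φ 2 ((J.plancherelMeasure.restrict S).prod volume) ∧
    ∀ᵐ p ∂J.plancherelMeasure.prod (volume : Measure ((Fin d → ℝ) × (Fin d → ℝ))),
      K p = S.indicator (fun lam => φ (lam, p.2.1) * conj (u p.2.2)) p.1}
  zero_mem' := by
    refine ⟨0, MemLp.zero, ?_⟩
    filter_upwards [Lp.coeFn_zero ℂ 2
      (J.plancherelMeasure.prod (volume : Measure ((Fin d → ℝ) × (Fin d → ℝ))))] with p hp
    rw [hp]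
    simp
  add_mem' := by
    rintro K M ⟨φ, hφ, hK⟩ ⟨ψ, hψ, hM⟩
    refine ⟨φ + ψ, hφ.add hψ, ?_⟩
    filter_upwards [Lp.coeFn_add K M, hK, hM] with p h h1 h2
    rw [h, Pi.add_apply, h1, h2]
    by_cases hp : p.1 ∈ S <;> simp [hp, add_mul]
  smul_mem' := by
    rintro c K ⟨φ, hφ, hK⟩
    refine ⟨c • φ, hφ.const_smul c, ?_⟩
    filter_upwards [Lp.coeFn_smul c K, hK] with p h h1
    rw [h, Pi.smul_apply, h1]
    by_cases hp : p.1 ∈ S <;> simp [hp, mul_assoc]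

/-- `𝒫⁻¹ (∫_S^⊕ (L²(ℝᵈ) ⊗ u) |det B(λ)| dλ) ⊆ L²(N)`. -/
def H (S : Set (Fin m → ℝ)) (u : L2R d) : Submodule ℂ (L2N J) :=
  (plancherelGraph J ⊓ Submodule.prod ⊤ (fiberSpace J S u)).map (LinearMap.fst ℂ (L2N J) (L2K J))

/-- `𝐇_E = 𝒫⁻¹ (∫_E^⊕ (L²(ℝᵈ) ⊗ u) |det B(λ)| dλ)`. -/
def HE (u : L2R d) : Submodule ℂ (L2N J) := H J J.E u

open scoped Pointwise in
/-- `𝐇_E^j = 𝒫⁻¹ (∫_{2^{-j}E}^⊕ (L²(ℝᵈ) ⊗ u) |det B(λ)| dλ)`. -/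
def HEj (j : ℤ) (u : L2R d) : Submodule ℂ (L2N J) := H J ((2 : ℝ) ^ (-j) • J.E) u

end Operators

/-- A family `(v_i)` of elements of the subspace `W` is a Parseval frame for `W`. -/
def IsParsevalFrame {V ι : Type*} [NormedAddCommGroup V] [InnerProductSpace ℂ V]
    (W : Submodule ℂ V) (v : ι → V) : Prop :=
  (∀ i, v i ∈ W) ∧ ∀ g ∈ W, HasSum (fun i => ‖inner ℂ g (v i)‖ ^ 2) (‖g‖ ^ 2)

end NilWavelet

end

open NilWavelet

/-!
In the coordinates `(z, y, x)` the operator `ℱf(λ)` has the integral kernel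
`K(λ, t, s) = ∫∫ f(z, y, t - s) e^{2πi⟨λ, z⟩} e^{-2πi⟨t, B(λ) y⟩} dz dy`, so up to the substitution
`(t, s) ↦ (η, x) = (B(λ)ᵀ t, t - s)`, whose Jacobian `|det B(λ)|` is the Plancherel density, the
transform `𝒫` is the Euclidean Fourier transform in the central and `Y` variables. The Euclidean
Plancherel theorem on almost every slice `x = const` then gives `‖f‖ = ‖K‖`
(`norm_eq_of_mem_fourierGraph`), which passes to the closed graph of `𝒫`.

Left translation by `γ` acts on kernels by a unimodular factor and a shift in `t`, and the dilation
`D_{A^j}` acts by `K(λ, t, s) ↦ c K(2^j λ, t, s)`, because `π_λ ∘ A^j = π_{2^j λ}`. Hence `L(γ)`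
preserves every space `H S u` and `D_{A^j}` maps `H S u` into `H (2^{-j} S) u`
(`L_mem_H`, `D_mem_H`); as `D_{A^j}` is unitary with inverse `D_{A^{-j}}`, the first three claims
follow. Orthogonality holds since the annuli `2^{-j} E` are pairwise disjoint.

For the decomposition of `H Σ u` one has to cut a kernel in the range of `𝒫` down to an annulus and
stay in the range. Surjectivity of `𝒫` is not needed for this: the range is closed, being the image
of a complete space under an isometry, and it is invariant under multiplication by the characters
`e^{2πi⟨λ, z⟩}`, which correspond to central translations; since an integrable function is determined
by its Fourier transform, it is invariant under multiplication by indicator functions of `λ`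
(`exists_mem_plancherelGraph_of_indicator`). An element of `H Σ u` orthogonal to all pieces has a
kernel vanishing on every annulus, and the annuli cover `Σ` because `0 ∉ Σ` when `d ≠ 0`.
-/

namespace NilWavelet

/-! ### Plancherel's theorem on `L¹ ∩ L²` -/

theorem eLpNorm_two_sq {α : Type*} [MeasurableSpace α] {μ : Measure α} (f : α → ℂ) :
    eLpNorm f 2 μ ^ 2 = ∫⁻ x, ‖f x‖ₑ ^ 2 ∂μ := by
  have h := eLpNorm_nnreal_pow_eq_lintegral (μ := μ) (f := f) (p := 2) two_ne_zero
  simp only [NNReal.coe_ofNat, ENNReal.rpow_ofNat, ENNReal.coe_ofNat] at h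
  exact h

open scoped FourierTransform SchwartzMap in
/-- On `L¹ ∩ L²` the `L²` Fourier transform is given by the Fourier integral: both define the same
tempered distribution. -/
theorem fourier_toLp_ae_eq {V : Type*} [NormedAddCommGroup V] [InnerProductSpace ℝ V]
    [FiniteDimensional ℝ V] [MeasurableSpace V] [BorelSpace V] {g : V → ℂ}
    (h1 : Integrable g) (h2 : MemLp g 2) : (𝓕 (h2.toLp g) : Lp ℂ 2 volume) =ᵐ[volume] 𝓕 g := by
  have hcont : Continuous (𝓕 g) := VectorFourier.fourierIntegral_continuous
    Real.continuous_fourierChar (by exact continuous_inner) h1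
  refine ae_eq_of_integral_contDiff_smul_eq
    ((Lp.memLp (𝓕 (h2.toLp g))).locallyIntegrable (by norm_num)) hcont.locallyIntegrable
    fun χ hχ hc => ?_
  -- Both sides are tested against a smooth compactly supported `χ`, viewed as a Schwartz function `φ`.
  have hχ' : ContDiff ℝ ((⊤ : ℕ∞) : WithTop ℕ∞) fun x => (χ x : ℂ) :=
    Complex.ofRealCLM.contDiff.comp hχ
  have hc' : HasCompactSupport fun x => (χ x : ℂ) :=
    hc.comp_left (g := ((↑) : ℝ → ℂ)) Complex.ofReal_zero
  let φ : 𝓢(V, ℂ) := hc'.toSchwartzMap hχ'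
  have hφ : ∀ x, φ x = χ x := fun x => rfl
  have h := congrArg (fun T => T φ) (Lp.fourier_toTemperedDistribution_eq (h2.toLp g))
  simp only [TemperedDistribution.fourier_apply, Lp.toTemperedDistribution_apply] at h
  calc ∫ x, χ x • (𝓕 (h2.toLp g) : Lp ℂ 2 volume) x
      = ∫ x, φ x • (𝓕 (h2.toLp g) : Lp ℂ 2 volume) x := by simp [hφ]
    _ = ∫ x, (𝓕 φ) x • (h2.toLp g) x := h.symm
    _ = ∫ x, (𝓕 φ) x • g x := by
      refine integral_congr_ae ?_
      filter_upwards [h2.coeFn_toLp] with x hx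
      rw [hx]
    _ = ∫ x, φ x • (𝓕 g) x := by
      have := VectorFourier.integral_fourierIntegral_smul_eq_flip (μ := (volume : Measure V))
        (ν := (volume : Measure V)) (L := innerₗ V) Real.continuous_fourierChar
        (by exact continuous_inner) φ.integrable h1
      rw [flip_innerₗ] at this
      rw [SchwartzMap.fourier_coe]
      exact this
    _ = _ := by
      have : ∀ x, φ x • (𝓕 g) x = χ x • (𝓕 g) x := fun x => by simp [hφ]
      simp only [this]

open scoped FourierTransform in
/-- Plancherel's theorem for the Fourier integral of a function in `L¹ ∩ L²`. -/
theorem lintegral_enorm_sq_fourier {V : Type*} [NormedAddCommGroup V] [InnerProductSpace ℝ V]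
    [FiniteDimensional ℝ V] [MeasurableSpace V] [BorelSpace V] {g : V → ℂ}
    (h1 : Integrable g) (h2 : MemLp g 2) : ∫⁻ w, ‖𝓕 g w‖ₑ ^ 2 = ∫⁻ v, ‖g v‖ₑ ^ 2 := by
  have h : eLpNorm (𝓕 g) 2 volume = eLpNorm g 2 volume := by
    rw [← eLpNorm_congr_ae (fourier_toLp_ae_eq h1 h2), ← eLpNorm_congr_ae h2.coeFn_toLp,
      ← Lp.enorm_def, ← Lp.enorm_def, ← ofReal_norm, ← ofReal_norm, Lp.norm_fourier_eq]
  rw [← eLpNorm_two_sq, ← eLpNorm_two_sq, h]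

/-! ### Functions with vanishing integrals over rectangles -/

/-- A function on a product is determined by its integrals over rectangles of finite measure. On a fixed
rectangle this is a π-system argument, and countably many rectangles exhaust the product. -/
theorem ae_eq_zero_of_forall_setIntegral_prod_eq_zero {α β : Type*} [MeasurableSpace α]
    [MeasurableSpace β] {μ : Measure α} {ν : Measure β} [SigmaFinite μ] [SigmaFinite ν]
    {h : α × β → ℂ}
    (hi : ∀ s t, MeasurableSet s → MeasurableSet t → μ s < ∞ → ν t < ∞ →
      IntegrableOn h (s ×ˢ t) (μ.prod ν))
    (hz : ∀ s t, MeasurableSet s → MeasurableSet t → μ s < ∞ → ν t < ∞ →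
      ∫ p in s ×ˢ t, h p ∂μ.prod ν = 0) : h =ᵐ[μ.prod ν] 0 := by
  have key : ∀ n, ∀ᵐ p ∂μ.prod ν, p ∈ spanningSets μ n ×ˢ spanningSets ν n → h p = 0 := by
    intro n
    have hS := measurableSet_spanningSets μ n
    have hT := measurableSet_spanningSets ν n
    have hint := hi _ _ hS hT (measure_spanningSets_lt_top μ n) (measure_spanningSets_lt_top ν n)
    rw [← ae_restrict_iff' (hS.prod hT)]
    refine Integrable.ae_eq_zero_of_forall_setIntegral_eq_zero hint fun A hA _ => ?_
    have huniv : ∫ p in spanningSets μ n ×ˢ spanningSets ν n, h p ∂μ.prod ν = 0 :=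
      hz _ _ hS hT (measure_spanningSets_lt_top μ n) (measure_spanningSets_lt_top ν n)
    refine MeasurableSpace.induction_on_inter
      (C := fun A _ => ∫ p in A, h p ∂(μ.prod ν).restrict
        (spanningSets μ n ×ˢ spanningSets ν n) = 0)
      generateFrom_prod.symm isPiSystem_prod (by simp) ?_ ?_ ?_ A hA
    · rintro - ⟨s, hs, t, ht, rfl⟩
      have hs : MeasurableSet s := hs
      have ht : MeasurableSet t := ht
      rw [Measure.restrict_restrict (hs.prod ht), Set.prod_inter_prod]
      exact hz _ _ (hs.inter hS) (ht.inter hT)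
        ((measure_mono Set.inter_subset_right).trans_lt (measure_spanningSets_lt_top μ n))
        ((measure_mono Set.inter_subset_right).trans_lt (measure_spanningSets_lt_top ν n))
    · intro t ht h0
      have := integral_add_compl ht hint
      rw [h0, zero_add, huniv] at this
      exact this
    · intro f hd hf h0
      rw [integral_iUnion hf hd hint.integrableOn]
      simp [h0]
  filter_upwards [ae_all_iff.2 key] with p hp
  obtain ⟨n, hn⟩ := Set.mem_iUnion.1 ((iUnion_spanningSets μ).symm ▸ Set.mem_univ p.1)
  obtain ⟨k, hk⟩ := Set.mem_iUnion.1 ((iUnion_spanningSets ν).symm ▸ Set.mem_univ p.2)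
  exact hp (max n k) ⟨monotone_spanningSets μ (le_max_left n k) hn,
    monotone_spanningSets ν (le_max_right n k) hk⟩

/-! ### Weighted composition operators -/

/-- The weighted composition operator `f ↦ w · (f ∘ T)` is bounded on `L²` when `T` scales the measure
and `w` is bounded. -/
theorem exists_weightedComp {α : Type*} [MeasurableSpace α] {μ : Measure α} {T : α → α}
    (hT : Measurable T) {c : ℝ≥0∞} (hc : c ≠ ∞) (hmap : μ.map T = c • μ) {w : α → ℂ}
    (hw : Measurable w) {C : ℝ} (hC : ∀ x, ‖w x‖ ≤ C) :
    ∃ W : Lp ℂ 2 μ →L[ℂ] Lp ℂ 2 μ, ∀ f, W f =ᵐ[μ] fun x => w x * f (T x) := by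
  have hq : Measure.QuasiMeasurePreserving T μ μ :=
    ⟨hT, by rw [hmap]; exact Measure.smul_absolutelyContinuous⟩
  have hcomp : ∀ f : Lp ℂ 2 μ, MemLp (fun x => f (T x)) 2 μ := fun f => by
    have h : MemLp f 2 (μ.map T) := by
      rw [hmap]
      exact (Lp.memLp f).smul_measure hc
    exact h.comp_of_map hT.aemeasurable
  have hmem : ∀ f : Lp ℂ 2 μ, MemLp (fun x => w x * f (T x)) 2 μ := fun f => by
    refine (hcomp f).of_le_mul (c := C) (hw.aestronglyMeasurable.mul (hcomp f).1)
      (Filter.Eventually.of_forall fun x => ?_)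
    rw [norm_mul]
    exact mul_le_mul_of_nonneg_right (hC x) (norm_nonneg _)
  let W : Lp ℂ 2 μ →ₗ[ℂ] Lp ℂ 2 μ :=
    { toFun := fun f => (hmem f).toLp _
      map_add' := fun f g => by
        rw [← MemLp.toLp_add]
        refine MemLp.toLp_congr _ _ ?_
        filter_upwards [hq.ae (Lp.coeFn_add f g)] with a ha
        simp only [Pi.add_apply] at ha ⊢
        rw [ha, mul_add]
      map_smul' := fun k f => by
        rw [RingHom.id_apply, ← MemLp.toLp_const_smul]
        refine MemLp.toLp_congr _ _ ?_
        filter_upwards [hq.ae (Lp.coeFn_smul k f)] with a ha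
        simp only [Pi.smul_apply, smul_eq_mul] at ha ⊢
        rw [ha]
        ring }
  refine ⟨W.mkContinuous (C * (c ^ (1 / (2 : ℝ≥0∞)).toReal).toReal) fun f => ?_,
    fun f => (hmem f).coeFn_toLp⟩
  have hcn : eLpNorm (fun x => f (T x)) 2 μ =
      c ^ (1 / (2 : ℝ≥0∞)).toReal * eLpNorm f 2 μ := by
    have h1 : eLpNorm f 2 (μ.map T) = eLpNorm (f ∘ T) 2 μ :=
      eLpNorm_map_measure (by rw [hmap]; exact (Lp.memLp f).1.smul_measure c) hT.aemeasurable
    rw [hmap, eLpNorm_smul_measure_of_ne_top (by norm_num)] at h1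
    exact h1.symm
  have h2 : ‖(hmem f).toLp _‖ ≤ C * ‖(hcomp f).toLp _‖ := by
    refine Lp.norm_le_mul_norm_of_ae_le_mul ?_
    filter_upwards [(hmem f).coeFn_toLp, (hcomp f).coeFn_toLp] with x h1 h2
    rw [h1, h2, norm_mul]
    exact mul_le_mul_of_nonneg_right (hC x) (norm_nonneg _)
  refine h2.trans_eq ?_
  rw [Lp.norm_toLp, hcn, ENNReal.toReal_mul, Lp.norm_def, mul_assoc]

/-! ### Uniqueness of Fourier transforms -/

/-- Real case of `setIntegral_preimage_eq_zero`: the finite measures with densities `r⁺` and `r⁻`, pushed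
forward by `π`, have the same characteristic function, so they coincide. -/
theorem setIntegral_preimage_eq_zero_of_real {α : Type*} [MeasurableSpace α] {μ : Measure α}
    {m : ℕ} {π : α → Fin m → ℝ} (hπ : Measurable π) {r : α → ℝ} (hr : Integrable r μ)
    (h : ∀ z : Fin m → ℝ, ∫ a, (r a : ℂ) *
      Complex.exp (((2 * Real.pi * (π a ⬝ᵥ z) : ℝ) : ℂ) * Complex.I) ∂μ = 0)
    {S : Set (Fin m → ℝ)} (hS : MeasurableSet S) : ∫ a in π ⁻¹' S, r a ∂μ = 0 := by
  let ρ : (α → ℝ) → Measure (Fin m → ℝ) := fun r =>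
    (μ.withDensity fun a => ENNReal.ofReal (r a)).map π
  have hfin : ∀ {r : α → ℝ}, Integrable r μ → IsFiniteMeasure (ρ r) := fun {r} hr => by
    have : IsFiniteMeasure (μ.withDensity fun a => ENNReal.ofReal (r a)) :=
      isFiniteMeasure_withDensity_ofReal hr.2
    infer_instance
  have hmeas : ∀ {r : α → ℝ}, Integrable r μ → ρ r S = ∫⁻ a in π ⁻¹' S, ENNReal.ofReal (r a) ∂μ :=
    fun {r} hr => by
      rw [Measure.map_apply hπ hS, withDensity_apply _ (hπ hS)]
  have hcf : ∀ {r : α → ℝ}, Integrable r μ → ∀ T : StrongDual ℝ (Fin m → ℝ),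
      charFunDual (ρ r) T =
        ∫ a, ((max (r a) 0 : ℝ) : ℂ) * Complex.exp ((T (π a) : ℂ) * Complex.I) ∂μ :=
    fun {r} hr T => by
      rw [charFunDual_apply, integral_map hπ.aemeasurable
        (by fun_prop : Continuous _).aestronglyMeasurable,
        integral_withDensity_eq_integral_toReal_smul₀ hr.1.aemeasurable.ennreal_ofReal
          (Filter.Eventually.of_forall fun _ => ENNReal.ofReal_lt_top)]
      simp only [ENNReal.toReal_ofReal', Complex.real_smul]
  have hρ : ρ r = ρ (-r) := by
    have := hfin hr
    have := hfin hr.neg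
    refine Measure.ext_of_charFunDual (funext fun T => ?_)
    rw [hcf hr, hcf hr.neg, ← sub_eq_zero, ← integral_sub]
    -- The functional `T` is the pairing with `2π z`, where `z` is the vector chosen here.
    · rw [← h fun k => (2 * Real.pi)⁻¹ * T (fun j => if k = j then 1 else 0)]
      refine integral_congr_ae (Filter.Eventually.of_forall fun a => ?_)
      have h1 : 2 * Real.pi * (π a ⬝ᵥ fun k => (2 * Real.pi)⁻¹ *
          T (fun j => if k = j then 1 else 0)) = T (π a) := by
        have h2 := T.toLinearMap.pi_apply_eq_sum_univ (π a)
        simp only [ContinuousLinearMap.coe_coe, smul_eq_mul] at h2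
        simp only [dotProduct, Finset.mul_sum]
        rw [h2]
        refine Finset.sum_congr rfl fun k _ => ?_
        have : Real.pi ≠ 0 := Real.pi_ne_zero
        field_simp
      simp only [h1, ← sub_mul, Pi.neg_apply]
      congr 1
      rw [← Complex.ofReal_sub]
      congr 1
      rcases le_total (r a) 0 with h0 | h0
      · rw [max_eq_right h0, max_eq_left (neg_nonneg.2 h0)]; ring
      · rw [max_eq_left h0, max_eq_right (neg_nonpos.2 h0)]; ring
    all_goals
      refine Integrable.mul_bdd (c := 1) ?_ ?_ (Filter.Eventually.of_forall fun a => ?_)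
      · first
          | exact hr.pos_part.ofReal
          | exact hr.neg.pos_part.ofReal
      · exact ((by fun_prop : Continuous fun v : Fin m → ℝ =>
          Complex.exp ((T v : ℂ) * Complex.I)).measurable.comp hπ).aestronglyMeasurable
      · rw [Complex.norm_exp_ofReal_mul_I]
  rw [integral_eq_lintegral_pos_part_sub_lintegral_neg_part hr.integrableOn, ← hmeas hr, hρ,
    hmeas hr.neg]
  simp

/-- If all integrals of `h` against characters of `π` vanish, then so do the integrals of `h` over the
sets defined by `π`. -/
theorem setIntegral_preimage_eq_zero {α : Type*} [MeasurableSpace α] {μ : Measure α}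
    {m : ℕ} {π : α → Fin m → ℝ} (hπ : Measurable π) {h : α → ℂ} (hh : Integrable h μ)
    (h0 : ∀ z : Fin m → ℝ, ∫ a, h a *
      Complex.exp (((2 * Real.pi * (π a ⬝ᵥ z) : ℝ) : ℂ) * Complex.I) ∂μ = 0)
    {S : Set (Fin m → ℝ)} (hS : MeasurableSet S) : ∫ a in π ⁻¹' S, h a ∂μ = 0 := by
  -- With `h`, its conjugate is annihilated too, which reduces the claim to real and imaginary parts.
  have hconj : ∀ z : Fin m → ℝ, ∫ a, conj (h a) *
      Complex.exp (((2 * Real.pi * (π a ⬝ᵥ z) : ℝ) : ℂ) * Complex.I) ∂μ = 0 := fun z => by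
    have := congrArg conj (h0 (-z))
    rw [← integral_conj, map_zero] at this
    rw [← this]
    refine integral_congr_ae (Filter.Eventually.of_forall fun a => ?_)
    simp only [map_mul, ← Complex.exp_conj, Complex.conj_ofReal, Complex.conj_I, dotProduct_neg]
    congr 2
    push_cast
    ring
  have hint : ∀ {k : α → ℂ}, Integrable k μ → ∀ z : Fin m → ℝ, Integrable (fun a => k a *
      Complex.exp (((2 * Real.pi * (π a ⬝ᵥ z) : ℝ) : ℂ) * Complex.I)) μ := fun {k} hk z => by
    refine hk.mul_bdd (c := 1) ?_ (Filter.Eventually.of_forall fun a => ?_)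
    · have : Continuous fun v : Fin m → ℝ =>
          Complex.exp (((2 * Real.pi * (v ⬝ᵥ z) : ℝ) : ℂ) * Complex.I) := by
        simp only [dotProduct]
        fun_prop
      exact (this.measurable.comp hπ).aestronglyMeasurable
    · rw [Complex.norm_exp_ofReal_mul_I]
  have hhc : Integrable (fun a => conj (h a)) μ := by
    simpa using Complex.conjCLE.toContinuousLinearMap.integrable_comp hh
  have hre : ∫ a in π ⁻¹' S, (h a).re ∂μ = 0 := by
    refine setIntegral_preimage_eq_zero_of_real hπ hh.re (fun z => ?_) hS
    have h1 := integral_add (hint hh z) (hint hhc z)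
    rw [h0, hconj, add_zero] at h1
    have h2 := integral_const_mul (μ := μ) (1 / 2 : ℂ) fun a => h a *
      Complex.exp (((2 * Real.pi * (π a ⬝ᵥ z) : ℝ) : ℂ) * Complex.I) + conj (h a) *
      Complex.exp (((2 * Real.pi * (π a ⬝ᵥ z) : ℝ) : ℂ) * Complex.I)
    rw [h1, mul_zero] at h2
    rw [← h2]
    refine integral_congr_ae (Filter.Eventually.of_forall fun a => ?_)
    simp only [RCLike.re_to_complex, Complex.re_eq_add_conj]
    ring
  have him : ∫ a in π ⁻¹' S, (h a).im ∂μ = 0 := by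
    refine setIntegral_preimage_eq_zero_of_real hπ hh.im (fun z => ?_) hS
    have h1 := integral_sub (hint hh z) (hint hhc z)
    rw [h0, hconj, sub_zero] at h1
    have h2 := integral_const_mul (μ := μ) (1 / (2 * Complex.I) : ℂ) fun a => h a *
      Complex.exp (((2 * Real.pi * (π a ⬝ᵥ z) : ℝ) : ℂ) * Complex.I) - conj (h a) *
      Complex.exp (((2 * Real.pi * (π a ⬝ᵥ z) : ℝ) : ℂ) * Complex.I)
    rw [h1, mul_zero] at h2
    rw [← h2]
    refine integral_congr_ae (Filter.Eventually.of_forall fun a => ?_)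
    simp only [RCLike.im_to_complex, Complex.im_eq_sub_conj]
    ring
  rw [← integral_re_add_im hh.integrableOn]
  simp only [RCLike.re_to_complex, RCLike.im_to_complex, hre, him]
  simp

/-! ### The degeneracy locus of a linear family of matrices -/

/-- On each line with direction `l` the determinant is a polynomial whose coefficient of degree `d` is
`det (B l) ≠ 0`, so it has finitely many zeros there. -/
theorem ae_det_ne_zero {m d : ℕ} (B : (Fin m → ℝ) →ₗ[ℝ] Matrix (Fin d) (Fin d) ℝ)
    {l : Fin m → ℝ} (hl : (B l).det ≠ 0) : ∀ᵐ v : Fin m → ℝ, (B v).det ≠ 0 := by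
  have hB0 : Continuous B := B.continuous_of_finiteDimensional
  have hB : Continuous fun v => (B v).det := hB0.matrix_det
  refine ae_mem_of_ae_add_linearMap_mem (LinearMap.toSpanSingleton ℝ (Fin m → ℝ) l) volume volume
    (s := {v | (B v).det ≠ 0}) (isOpen_ne_fun hB continuous_const).measurableSet fun y => ?_
  let p : Polynomial ℝ :=
    ((Polynomial.X : Polynomial ℝ) • (B l).map Polynomial.C + (B y).map Polynomial.C).det
  have hp : p ≠ 0 := by
    intro h0
    apply hl
    rw [← Polynomial.coeff_det_X_add_C_card (B l) (B y)]
    exact (congrArg (fun q => Polynomial.coeff q _) h0).trans (Polynomial.coeff_zero _)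
  have hev : ∀ s : ℝ, p.eval s = (B (y + s • l)).det := fun s => by
    rw [← Polynomial.coe_evalRingHom, RingHom.map_det]
    congr 1
    ext i j
    simp [add_comm]
    exact mul_comm _ _
  have hfin : {s : ℝ | p.IsRoot s}.Finite := Polynomial.finite_setOfPred_isRoot hp
  have := hfin.countable.ae_notMem (volume : Measure ℝ)
  filter_upwards [this] with s hs
  simpa [Polynomial.IsRoot, hev] using hs

/-! ### Partial Fourier transform and change of variables -/

/-- The plane wave `(z, y) ↦ e^{2πi⟨λ, z⟩} e^{-2πi⟨η, y⟩}` with frequency `w = (λ, η)`. The signs are those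
of the representations `π_λ`. -/
@[irreducible] noncomputable def planeWave {m d : ℕ} (w q : (Fin m → ℝ) × (Fin d → ℝ)) : ℂ :=
  Complex.exp (((2 * Real.pi * (w.1 ⬝ᵥ q.1) : ℝ) : ℂ) * Complex.I) *
    Complex.exp (((-(2 * Real.pi * (w.2 ⬝ᵥ q.2)) : ℝ) : ℂ) * Complex.I)

/-- Plancherel's theorem on `ℝᵐ × ℝᵈ`, transported from the Euclidean space of dimension `m + d`; the
map `λ ↦ -λ` accounts for the sign convention of `planeWave`. -/
theorem lintegral_enorm_sq_integral_planeWave {m d : ℕ} {g : (Fin m → ℝ) × (Fin d → ℝ) → ℂ}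
    (h1 : Integrable g) (h2 : MemLp g 2) :
    ∫⁻ w, ‖∫ q, g q * planeWave w q‖ₑ ^ 2 = ∫⁻ q, ‖g q‖ₑ ^ 2 := by
  let e : EuclideanSpace ℝ (Fin m ⊕ Fin d) ≃ᵐ (Fin m → ℝ) × (Fin d → ℝ) :=
    (MeasurableEquiv.toLp 2 (Fin m ⊕ Fin d → ℝ)).symm.trans
      (MeasurableEquiv.sumPiEquivProdPi fun _ => ℝ)
  have he : MeasurePreserving e volume volume :=
    (volume_measurePreserving_sumPiEquivProdPi fun _ => ℝ).comp
      (EuclideanSpace.volume_preserving_symm_measurableEquiv_toLp _)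
  have he1 : ∀ v k, (e v).1 k = v (.inl k) := fun v k => rfl
  have he2 : ∀ v k, (e v).2 k = v (.inr k) := fun v k => rfl
  have hneg : MeasurePreserving (fun w : (Fin m → ℝ) × (Fin d → ℝ) => (-w.1, w.2))
      volume volume := (Measure.measurePreserving_neg volume).prod (MeasurePreserving.id volume)
  have hnege : MeasurableEmbedding (fun w : (Fin m → ℝ) × (Fin d → ℝ) => (-w.1, w.2)) :=
    ((MeasurableEquiv.neg (Fin m → ℝ)).prodCongr (MeasurableEquiv.refl _)).measurableEmbedding
  have hF : ∀ w, FourierTransform.fourier (g ∘ e) w =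
      ∫ q, g q * planeWave (-(e w).1, (e w).2) q := fun w => by
    rw [Real.fourier_eq', ← he.integral_comp e.measurableEmbedding]
    refine integral_congr_ae (Filter.Eventually.of_forall fun v => ?_)
    simp only [planeWave, ← Complex.exp_add, Function.comp, smul_eq_mul]
    rw [mul_comm]
    congr 2
    simp only [PiLp.inner_apply, Fintype.sum_sum_type, dotProduct, Pi.neg_apply, he1, he2]
    simp only [RCLike.inner_apply, conj_trivial]
    push_cast
    simp only [Finset.mul_sum, Finset.sum_mul, mul_add, add_mul, neg_mul, mul_neg,
      Finset.sum_neg_distrib]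
  have := lintegral_enorm_sq_fourier (he.integrable_comp_of_integrable h1)
    (h2.comp_measurePreserving he)
  simp only [hF] at this
  rw [he.lintegral_comp_emb e.measurableEmbedding
      (fun w => ‖∫ q, g q * planeWave (-w.1, w.2) q‖ₑ ^ 2),
    hneg.lintegral_comp_emb hnege (fun w => ‖∫ q, g q * planeWave w q‖ₑ ^ 2)] at this
  rw [this]
  exact he.lintegral_comp_emb e.measurableEmbedding (fun q => ‖g q‖ₑ ^ 2)

/-- The shear `(t, s) ↦ (t, t - s)` takes the kernel variables to the variables `(t, x)`. -/
theorem measurePreserving_sub_shear (d : ℕ) :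
    MeasurePreserving (fun p : (Fin d → ℝ) × (Fin d → ℝ) => (p.1, p.1 - p.2)) volume volume :=
  (MeasurePreserving.id volume).skew_product (g := fun t s => t - s) (by fun_prop)
    (Filter.Eventually.of_forall fun t => (Measure.measurePreserving_sub_left volume t).map_eq)

theorem measurableEmbedding_sub_shear (d : ℕ) :
    MeasurableEmbedding (fun p : (Fin d → ℝ) × (Fin d → ℝ) => (p.1, p.1 - p.2)) :=
  (MeasurableEquiv.ofInvolutive _ (fun p => by simp) (by fun_prop :
    Measurable fun p : (Fin d → ℝ) × (Fin d → ℝ) => (p.1, p.1 - p.2))).measurableEmbedding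

section Kernel

variable {d : ℕ} {Q : Type*} [MeasurableSpace Q] {ν : Measure Q}
  {g : (Fin d → ℝ) × Q → ℂ} {P : (Fin d → ℝ) × Q → ℂ}

/-- Integrability of the integrand, in the variables `(t, (x, q))`, of the pairing of `1_S` with the
operator with kernel `∫ q, g (t - s, q) P (t, q)` applied to `1_T`. -/
theorem integrable_kernelIntegrand (hg : Integrable g (volume.prod ν)) (hP : Measurable P)
    (hP1 : ∀ p, ‖P p‖ ≤ 1) {S T : Set (Fin d → ℝ)} (hS : MeasurableSet S) (hT : MeasurableSet T)
    (hS' : volume S < ∞) :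
    Integrable (fun p : (Fin d → ℝ) × ((Fin d → ℝ) × Q) =>
      g p.2 * (P (p.1, p.2.2) * T.indicator 1 (p.1 - p.2.1) * S.indicator 1 p.1))
      (volume.prod (volume.prod ν)) := by
  have h1 : Integrable (S.indicator (1 : (Fin d → ℝ) → ℂ)) volume :=
    (integrable_indicator_iff hS).2 (integrableOn_const hS'.ne)
  have h2 := h1.mul_prod hg
  refine (h2.mul_bdd (c := 1) (g := fun p : (Fin d → ℝ) × ((Fin d → ℝ) × Q) =>
    P (p.1, p.2.2) * T.indicator 1 (p.1 - p.2.1)) ?_ ?_).congr ?_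
  · refine Measurable.aestronglyMeasurable (Measurable.mul ?_ ?_)
    · exact hP.comp (by fun_prop)
    · exact (measurable_one.indicator hT).comp (by fun_prop)
  · refine Filter.Eventually.of_forall fun p => ?_
    rw [norm_mul]
    refine mul_le_one₀ (hP1 _) (norm_nonneg _) ?_
    refine (norm_indicator_le_norm_self _ _).trans ?_
    simp
  · exact Filter.Eventually.of_forall fun p => by ring

/-- The kernel `∫ q, g (t - s, q) P (t, q)` is integrable over rectangles `S × T`, and its integral is the
superposition, with weights `g (x, q)`, of the pairings of `1_S` with the operators
`φ ↦ P (·, q) φ(· - x)` applied to `1_T`. -/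
theorem integrableOn_kernel_and_setIntegral_eq [SFinite ν]
    (hg : Integrable g (volume.prod ν)) (hP : Measurable P)
    (hP1 : ∀ p, ‖P p‖ ≤ 1) {S T : Set (Fin d → ℝ)} (hS : MeasurableSet S) (hT : MeasurableSet T)
    (hS' : volume S < ∞) :
    IntegrableOn (fun p : (Fin d → ℝ) × (Fin d → ℝ) => ∫ q, g (p.1 - p.2, q) * P (p.1, q) ∂ν)
      (S ×ˢ T) ∧
    ∫ p in S ×ˢ T, (∫ q, g (p.1 - p.2, q) * P (p.1, q) ∂ν) =
      ∫ p, (g p * ∫ t, P (t, p.2) * T.indicator 1 (t - p.1) * S.indicator 1 t)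
        ∂(volume.prod ν) := by
  have hI := integrable_kernelIntegrand hg hP hP1 hS hT hS'
  have hmp : MeasurePreserving (fun p : ((Fin d → ℝ) × (Fin d → ℝ)) × Q =>
      (p.1.1, (p.1.1 - p.1.2, p.2))) (volume.prod ν) (volume.prod (volume.prod ν)) :=
    (measurePreserving_prodAssoc volume volume ν).comp
      ((measurePreserving_sub_shear d).prod (MeasurePreserving.id ν))
  have hme : MeasurableEmbedding (fun p : ((Fin d → ℝ) × (Fin d → ℝ)) × Q =>
      (p.1.1, (p.1.1 - p.1.2, p.2))) :=
    MeasurableEquiv.prodAssoc.measurableEmbedding.comp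
      ((measurableEmbedding_sub_shear d).prodMap MeasurableEmbedding.id)
  have hI2 := hmp.integrable_comp_of_integrable hI
  have heq : ∀ p : (Fin d → ℝ) × (Fin d → ℝ),
      ∫ q, g (p.1 - p.2, q) * (P (p.1, q) * T.indicator 1 (p.1 - (p.1 - p.2)) *
        S.indicator 1 p.1) ∂ν =
      (S ×ˢ T).indicator (fun p => ∫ q, g (p.1 - p.2, q) * P (p.1, q) ∂ν) p := fun p => by
    rw [sub_sub_cancel]
    by_cases h1 : p.1 ∈ S <;> by_cases h2 : p.2 ∈ T <;> simp [h1, h2, Set.indicator]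
  refine ⟨?_, ?_⟩
  · rw [← integrable_indicator_iff (hS.prod hT)]
    exact hI2.integral_prod_left.congr (Filter.Eventually.of_forall heq)
  · rw [← integral_indicator (hS.prod hT)]
    simp_rw [← heq]
    have e1 := integral_prod _ hI2
    simp only [Function.comp_apply] at e1
    change _ = ∫ p : (Fin d → ℝ) × (Fin d → ℝ), ∫ q, g (p.1 - p.2, q) *
      (P (p.1, q) * T.indicator 1 (p.1 - (p.1 - p.2)) * S.indicator 1 p.1) ∂ν at e1
    rw [← e1, hmp.integral_comp hme (fun p : (Fin d → ℝ) × ((Fin d → ℝ) × Q) =>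
      g p.2 * (P (p.1, p.2.2) * T.indicator 1 (p.1 - p.2.1) * S.indicator 1 p.1)),
      integral_prod_symm _ hI]
    refine integral_congr_ae (Filter.Eventually.of_forall fun p => ?_)
    exact integral_const_mul (g p) _

end Kernel

section Plancherel

variable {m d : ℕ} {g : (Fin d → ℝ) × ((Fin m → ℝ) × (Fin d → ℝ)) → ℂ}

theorem continuous_planeWave : Continuous fun p : ((Fin m → ℝ) × (Fin d → ℝ)) ×
    ((Fin m → ℝ) × (Fin d → ℝ)) => planeWave p.1 p.2 := by
  unfold planeWave
  simp only [dotProduct]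
  fun_prop

theorem norm_planeWave (w q : (Fin m → ℝ) × (Fin d → ℝ)) : ‖planeWave w q‖ = 1 := by
  rw [planeWave, norm_mul, Complex.norm_exp_ofReal_mul_I, Complex.norm_exp_ofReal_mul_I, one_mul]

/-- The Fourier transform of `g` in its second variable, with the sign convention of `planeWave`. -/
@[irreducible] noncomputable def partialFourier
    (g : (Fin d → ℝ) × ((Fin m → ℝ) × (Fin d → ℝ)) → ℂ)
    (p : (Fin d → ℝ) × ((Fin m → ℝ) × (Fin d → ℝ))) : ℂ :=
  ∫ q, g (p.1, q) * planeWave p.2 q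

theorem measurable_partialFourier (hg : StronglyMeasurable g) :
    Measurable (partialFourier g) := by
  have h1 : Measurable fun p : ((Fin d → ℝ) × ((Fin m → ℝ) × (Fin d → ℝ))) ×
      ((Fin m → ℝ) × (Fin d → ℝ)) => planeWave p.1.2 p.2 :=
    continuous_planeWave.measurable.comp
      ((measurable_snd.comp measurable_fst).prodMk measurable_snd)
  have h2 : Measurable fun p : ((Fin d → ℝ) × ((Fin m → ℝ) × (Fin d → ℝ))) ×
      ((Fin m → ℝ) × (Fin d → ℝ)) => g (p.1.1, p.2) :=
    hg.measurable.comp ((measurable_fst.comp measurable_fst).prodMk measurable_snd)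
  have h3 : partialFourier g = fun p => ∫ q, g (p.1, q) * planeWave p.2 q := by
    ext p
    rw [partialFourier]
  rw [h3]
  exact (h2.mul h1).stronglyMeasurable.integral_prod_right'.measurable

/-- The factor `|det B|` is the Jacobian of the substitution `η = Bᵀ t`. -/
theorem lintegral_kernel_mul_det (hg : StronglyMeasurable g) (l : Fin m → ℝ)
    {B : Matrix (Fin d) (Fin d) ℝ} (hB : B.det ≠ 0) :
    ENNReal.ofReal |B.det| * ∫⁻ p : (Fin d → ℝ) × (Fin d → ℝ),
      ‖partialFourier g (p.1 - p.2, (l, Matrix.vecMul p.1 B))‖ₑ ^ 2 =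
    ∫⁻ x : Fin d → ℝ, ∫⁻ η : Fin d → ℝ, ‖partialFourier g (x, (l, η))‖ₑ ^ 2 := by
  have hm := (measurable_partialFourier hg).enorm.pow_const 2
  rw [(measurePreserving_sub_shear d).lintegral_comp_emb (measurableEmbedding_sub_shear d)
    (fun p => ‖partialFourier g (p.2, (l, Matrix.vecMul p.1 B))‖ₑ ^ 2)]
  have hlin : ∀ t, Matrix.vecMul t B = Matrix.toLin' B.transpose t := fun t => by
    rw [Matrix.toLin'_apply, Matrix.mulVec_transpose]
  have hlm : Measurable fun t => Matrix.vecMul t B := by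
    simp_rw [hlin]
    exact (LinearMap.continuous_of_finiteDimensional _).measurable
  have hsymm := lintegral_prod_symm' (μ := (volume : Measure (Fin d → ℝ)))
    (ν := (volume : Measure (Fin d → ℝ)))
    (fun p => ‖partialFourier g (p.2, (l, Matrix.vecMul p.1 B))‖ₑ ^ 2)
    (hm.comp (by fun_prop : Measurable fun p : (Fin d → ℝ) × (Fin d → ℝ) =>
      (p.2, (l, Matrix.vecMul p.1 B))))
  rw [← Measure.volume_eq_prod] at hsymm
  rw [hsymm, ← lintegral_const_mul' _ _ ENNReal.ofReal_ne_top]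
  refine lintegral_congr fun x => ?_
  have hmx : Measurable fun η : Fin d → ℝ => ‖partialFourier g (x, (l, η))‖ₑ ^ 2 :=
    hm.comp (by fun_prop : Measurable fun η : Fin d → ℝ => (x, (l, η)))
  have hmap := Real.map_matrix_volume_pi_eq_smul_volume_pi (M := B.transpose)
    (by rwa [Matrix.det_transpose])
  have h := lintegral_map (μ := volume) hmx
    (LinearMap.continuous_of_finiteDimensional (Matrix.toLin' B.transpose)).measurable
  rw [hmap, lintegral_smul_measure] at h
  simp_rw [hlin]
  rw [← h, Matrix.det_transpose, smul_eq_mul, ← mul_assoc, ← ENNReal.ofReal_mul (abs_nonneg _),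
    ← abs_mul, mul_inv_cancel₀ hB, abs_one, ENNReal.ofReal_one, one_mul]

theorem lintegral_partialFourier (hg : StronglyMeasurable g) (h1 : Integrable g)
    (h2 : MemLp g 2) :
    ∫⁻ l : Fin m → ℝ, ∫⁻ x : Fin d → ℝ, ∫⁻ η : Fin d → ℝ,
      ‖partialFourier g (x, (l, η))‖ₑ ^ 2 = ∫⁻ p, ‖g p‖ₑ ^ 2 := by
  have hm := (measurable_partialFourier hg).enorm.pow_const 2
  have h2' : Integrable fun p => ‖g p‖ ^ 2 :=
    (memLp_two_iff_integrable_sq_norm hg.aestronglyMeasurable).1 h2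
  calc _ = ∫⁻ x : Fin d → ℝ, ∫⁻ l : Fin m → ℝ, ∫⁻ η : Fin d → ℝ,
        ‖partialFourier g (x, (l, η))‖ₑ ^ 2 := by
        rw [lintegral_lintegral_swap]
        have h : Measurable fun p : ((Fin m → ℝ) × (Fin d → ℝ)) × (Fin d → ℝ) =>
            ‖partialFourier g (p.1.2, (p.1.1, p.2))‖ₑ ^ 2 :=
          hm.comp ((measurable_snd.comp measurable_fst).prodMk
            ((measurable_fst.comp measurable_fst).prodMk measurable_snd))
        exact h.lintegral_prod_right'.aemeasurable
    _ = ∫⁻ x : Fin d → ℝ, ∫⁻ w : (Fin m → ℝ) × (Fin d → ℝ),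
        ‖partialFourier g (x, w)‖ₑ ^ 2 := by
        refine lintegral_congr fun x => ?_
        exact (lintegral_prod (fun w : (Fin m → ℝ) × (Fin d → ℝ) =>
          ‖partialFourier g (x, w)‖ₑ ^ 2) (hm.comp (by fun_prop : Measurable
            fun w : (Fin m → ℝ) × (Fin d → ℝ) => (x, w))).aemeasurable).symm
    _ = ∫⁻ x : Fin d → ℝ, ∫⁻ q : (Fin m → ℝ) × (Fin d → ℝ), ‖g (x, q)‖ₑ ^ 2 := by
        refine lintegral_congr_ae ?_
        rw [Measure.volume_eq_prod] at h1 h2'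
        filter_upwards [h1.prod_right_ae, h2'.prod_right_ae] with x hx1 hx2
        simp only [partialFourier]
        exact lintegral_enorm_sq_integral_planeWave hx1
          ((memLp_two_iff_integrable_sq_norm hx1.1).2 hx2)
    _ = _ := by
        exact (lintegral_prod _ (hg.measurable.enorm.pow_const 2).aemeasurable).symm

end Plancherel

open NilGroup

variable {𝔫 : Type*} [LieRing 𝔫] [LieAlgebra ℝ 𝔫] {m d : ℕ}

/-! ### The integral kernel of the Fourier transform on `N` -/

variable (J : JHBasis 𝔫 m d) in
/-- The coordinates of `N` in the order `(x, (z, y))`, separating the variable `x = t - s` from the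
variables in which the Euclidean Fourier transform is taken. -/
noncomputable def splitCoord : NilGroup J ≃ᵐ (Fin d → ℝ) × ((Fin m → ℝ) × (Fin d → ℝ)) :=
  (coordM J).trans (MeasurableEquiv.prodAssoc.symm.trans MeasurableEquiv.prodComm)

variable {J : JHBasis 𝔫 m d}

theorem splitCoord_apply (a : NilGroup J) :
    splitCoord J a = ((coord J a).2.2, ((coord J a).1, (coord J a).2.1)) := rfl

theorem measurePreserving_splitCoord :
    MeasurePreserving (splitCoord J) (haar J) volume :=
  (Measure.measurePreserving_swap.comp (measurePreserving_prodAssoc volume volume volume).symm).comp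
    measurePreserving_coordM

theorem phase_eq_planeWave (lam : Fin m → ℝ) (p : Coord m d) (t : Fin d → ℝ) :
    phase lam p t J = planeWave (lam, Matrix.vecMul t (J.B lam)) (p.1, p.2.1) := by
  rw [phase, planeWave, Matrix.dotProduct_mulVec]

theorem inner_rep_indicator (lam : Fin m → ℝ) (a : NilGroup J) {S T : Set (Fin d → ℝ)}
    (hS : MeasurableSet S) (hT : MeasurableSet T) (hS' : volume S ≠ ∞) (hT' : volume T ≠ ∞) :
    inner ℂ (indicatorConstLp 2 hS hS' (1 : ℂ)) (rep lam a (indicatorConstLp 2 hT hT' (1 : ℂ))) =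
      ∫ t, planeWave (lam, Matrix.vecMul t (J.B lam)) (splitCoord J a).2 *
        T.indicator 1 (t - (splitCoord J a).1) * S.indicator 1 t := by
  rw [L2.inner_def]
  refine integral_congr_ae ?_
  filter_upwards [(memLp_repFun lam a
    (Lp.memLp (indicatorConstLp 2 hT hT' (1 : ℂ)))).coeFn_toLp,
    indicatorConstLp_coeFn (p := 2) (hs := hS) (hμs := hS') (c := (1 : ℂ)),
    ae_sub (indicatorConstLp_coeFn (p := 2) (hs := hT) (hμs := hT') (c := (1 : ℂ)))
      (coord J a).2.2] with t h1 h2 h3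
  change inner ℂ _ ((memLp_repFun lam a
    (Lp.memLp (indicatorConstLp 2 hT hT' (1 : ℂ)))).toLp _ t) = _
  rw [h1, h2, repFun, h3, phase_eq_planeWave, splitCoord_apply]
  by_cases ht : t ∈ S <;> simp [ht, Set.indicator]

/-- The kernel of `ℱf(λ)` is the partial Fourier transform of `f` at `x = t - s` with frequency
`(λ, B(λ)ᵀ t)`: the two kernels have the same integrals over rectangles. -/
theorem ae_eq_partialFourier_of_mem_fourierGraph {f : L2N J} {K : L2K J}
    (h : (f, K) ∈ fourierGraph J) : ∀ᵐ lam ∂J.plancherelMeasure,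
      ∀ᵐ p : (Fin d → ℝ) × (Fin d → ℝ), K (lam, p) =
        partialFourier (f ∘ (splitCoord J).symm)
          (p.1 - p.2, (lam, Matrix.vecMul p.1 (J.B lam))) := by
  obtain ⟨hf, hK⟩ := h
  have hmp := (measurePreserving_splitCoord (J := J)).symm (splitCoord J)
  have hg : Integrable (f ∘ (splitCoord J).symm) volume := hmp.integrable_comp_of_integrable hf
  filter_upwards [hK, integrable_kernel K] with lam h1 h2
  let P : (Fin d → ℝ) × ((Fin m → ℝ) × (Fin d → ℝ)) → ℂ :=
    fun p => planeWave (lam, Matrix.vecMul p.1 (J.B lam)) p.2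
  have hP : Measurable P := by
    have hv : Continuous fun t : Fin d → ℝ => Matrix.vecMul t (J.B lam) :=
      (Matrix.vecMulLinear (J.B lam)).continuous_of_finiteDimensional
    have h3 : Measurable fun p : (Fin d → ℝ) × ((Fin m → ℝ) × (Fin d → ℝ)) =>
        ((lam, Matrix.vecMul p.1 (J.B lam)), p.2) :=
      (measurable_const.prodMk (hv.measurable.comp measurable_fst)).prodMk measurable_snd
    exact continuous_planeWave.measurable.comp h3
  have hP1 : ∀ p, ‖P p‖ ≤ 1 := fun p => (norm_planeWave _ _).le
  have hk : ∀ p : (Fin d → ℝ) × (Fin d → ℝ), partialFourier (f ∘ (splitCoord J).symm)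
      (p.1 - p.2, (lam, Matrix.vecMul p.1 (J.B lam))) =
      ∫ q, (f ∘ (splitCoord J).symm) (p.1 - p.2, q) * P (p.1, q) := fun p => by
    rw [partialFourier]
  have hφ : ∀ {S T : Set (Fin d → ℝ)} (hS : MeasurableSet S) (hT : MeasurableSet T)
      (hS' : volume S ≠ ∞) (hT' : volume T ≠ ∞),
      (fun q : (Fin d → ℝ) × (Fin d → ℝ) => K (lam, q) *
        (indicatorConstLp 2 hT hT' (1 : ℂ)) q.2 * conj ((indicatorConstLp 2 hS hS' (1 : ℂ)) q.1))
      =ᵐ[volume] (S ×ˢ T).indicator fun q => K (lam, q) := fun {S T} hS hT hS' hT' => by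
    filter_upwards [Measure.quasiMeasurePreserving_fst.ae
      (indicatorConstLp_coeFn (p := 2) (hs := hS) (hμs := hS') (c := (1 : ℂ))),
      Measure.quasiMeasurePreserving_snd.ae
      (indicatorConstLp_coeFn (p := 2) (hs := hT) (hμs := hT') (c := (1 : ℂ)))] with q h1 h2
    rw [h1, h2]
    by_cases h3 : q.1 ∈ S <;> by_cases h4 : q.2 ∈ T <;> simp [h3, h4, Set.indicator]
  have hKi : ∀ {S T : Set (Fin d → ℝ)}, MeasurableSet S → MeasurableSet T →
      volume S < ∞ → volume T < ∞ → IntegrableOn (fun q => K (lam, q)) (S ×ˢ T) :=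
    fun {S T} hS hT hS' hT' => by
    rw [← integrable_indicator_iff (hS.prod hT)]
    exact (h2 _ _).congr (hφ hS hT hS'.ne hT'.ne)
  have hmain := ae_eq_zero_of_forall_setIntegral_prod_eq_zero
    (μ := (volume : Measure (Fin d → ℝ))) (ν := (volume : Measure (Fin d → ℝ)))
    (h := fun q => K (lam, q) -
      ∫ r, (f ∘ (splitCoord J).symm) (q.1 - q.2, r) * P (q.1, r))
    (fun S T hS hT hS' hT' => (hKi hS hT hS' hT').sub
      (integrableOn_kernel_and_setIntegral_eq hg hP hP1 hS hT hS').1) fun S T hS hT hS' hT' => by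
    obtain ⟨i1, i2⟩ := integrableOn_kernel_and_setIntegral_eq hg hP hP1 hS hT hS'
    refine (integral_sub (hKi hS hT hS' hT') i1).trans (sub_eq_zero.2 ?_)
    refine Eq.trans ?_ i2.symm
    have h3 := h1 (indicatorConstLp 2 hT hT'.ne 1) (indicatorConstLp 2 hS hS'.ne 1)
    rw [integral_congr_ae (hφ hS hT hS'.ne hT'.ne), integral_indicator (hS.prod hT)] at h3
    refine h3.trans ?_
    simp_rw [inner_rep_indicator]
    rw [← Measure.volume_eq_prod, ← (measurePreserving_splitCoord (J := J)).integral_comp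
      (splitCoord J).measurableEmbedding]
    simp [P]
  filter_upwards [hmain] with p hp
  rw [hk]
  exact sub_eq_zero.1 hp

/-! ### The Plancherel measure and the isometry -/

theorem apply_lie_X_Y (l : Module.Dual ℝ 𝔫) (i j : Fin d) : l ⁅J.X i, J.Y j⁆ =
    ∑ k, l (J.basis (.inl k)) * J.basis.repr ⁅J.X i, J.Y j⁆ (.inl k) := by
  conv_lhs => rw [← J.basis.sum_repr ⁅J.X i, J.Y j⁆]
  rw [Fintype.sum_sum_type, map_add, map_sum, map_sum]
  simp [repr_of_mem_center (J.lie_mem_center _ _), mul_comm]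

theorem B_apply (lam : Fin m → ℝ) (i j : Fin d) : J.B lam i j =
    ∑ k, lam k * J.basis.repr ⁅J.X i, J.Y j⁆ (.inl k) := by
  have h : ∀ k, J.functional lam (J.basis (.inl k)) = lam k := fun k => by
    simp [JHBasis.functional]
  rw [JHBasis.B, Matrix.of_apply, apply_lie_X_Y]
  simp_rw [h]

variable (J) in
/-- `λ ↦ B(λ)` as a linear map. -/
noncomputable def linB : (Fin m → ℝ) →ₗ[ℝ] Matrix (Fin d) (Fin d) ℝ where
  toFun := J.B
  map_add' x y := by
    ext i j
    simp only [B_apply, Matrix.add_apply, Pi.add_apply, add_mul, Finset.sum_add_distrib]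
  map_smul' c x := by
    ext i j
    simp only [B_apply, Matrix.smul_apply, Pi.smul_apply, smul_eq_mul, mul_assoc,
      Finset.mul_sum, RingHom.id_apply]

theorem B_smul (c : ℝ) (lam : Fin m → ℝ) : J.B (c • lam) = c • J.B lam :=
  (linB J).map_smul c lam

theorem continuous_B : Continuous J.B := (linB J).continuous_of_finiteDimensional

/-- The functional witnessing nondegeneracy may take nonzero values at the `X_i` and `Y_i`, but only its
restriction to the centre enters the determinant. -/
theorem ae_mem_Sigma : ∀ᵐ lam : Fin m → ℝ, lam ∈ J.Sigma := by
  obtain ⟨l, hl⟩ := J.det_ne_zero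
  refine ae_det_ne_zero (linB J) (l := fun k => l (J.basis (.inl k))) ?_
  convert hl using 2
  ext i j
  exact (B_apply _ i j).trans (apply_lie_X_Y l i j).symm

theorem measurableSet_Sigma : MeasurableSet J.Sigma :=
  (isOpen_ne_fun continuous_B.matrix_det continuous_const).measurableSet

theorem lintegral_plancherelMeasure (F : (Fin m → ℝ) → ℝ≥0∞) :
    ∫⁻ lam, F lam ∂J.plancherelMeasure = ∫⁻ lam, ENNReal.ofReal |(J.B lam).det| * F lam := by
  rw [JHBasis.plancherelMeasure, Measure.restrict_eq_self_of_ae_mem ae_mem_Sigma,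
    lintegral_withDensity_eq_lintegral_mul_non_measurable]
  · rfl
  · exact (continuous_B.matrix_det.abs.measurable).ennreal_ofReal
  · exact Filter.Eventually.of_forall fun _ => ENNReal.ofReal_lt_top

/-- The Plancherel formula on `L¹(N) ∩ L²(N)`. -/
theorem norm_eq_of_mem_fourierGraph {f : L2N J} {K : L2K J} (h : (f, K) ∈ fourierGraph J) :
    ‖f‖ = ‖K‖ := by
  have hmp := (measurePreserving_splitCoord (J := J)).symm (splitCoord J)
  have hg : Integrable (f ∘ (splitCoord J).symm) volume := hmp.integrable_comp_of_integrable h.1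
  have hg2 : MemLp (f ∘ (splitCoord J).symm) 2 volume :=
    (Lp.memLp f).comp_measurePreserving hmp
  have hgm : StronglyMeasurable (f ∘ (splitCoord J).symm) :=
    (Lp.stronglyMeasurable f).comp_measurable (splitCoord J).symm.measurable
  have hsq : eLpNorm K 2 (J.plancherelMeasure.prod volume) ^ 2 = eLpNorm f 2 (haar J) ^ 2 := by
    rw [eLpNorm_two_sq, eLpNorm_two_sq,
      lintegral_prod _ ((Lp.stronglyMeasurable K).measurable.enorm.pow_const 2).aemeasurable]
    calc _ = ∫⁻ lam, (∫⁻ p : (Fin d → ℝ) × (Fin d → ℝ),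
          ‖partialFourier (f ∘ (splitCoord J).symm)
            (p.1 - p.2, (lam, Matrix.vecMul p.1 (J.B lam)))‖ₑ ^ 2) ∂J.plancherelMeasure := by
          refine lintegral_congr_ae ?_
          filter_upwards [ae_eq_partialFourier_of_mem_fourierGraph h] with lam hlam
          refine lintegral_congr_ae ?_
          filter_upwards [hlam] with p hp
          rw [hp]
      _ = ∫⁻ lam, ∫⁻ x : Fin d → ℝ, ∫⁻ η : Fin d → ℝ,
          ‖partialFourier (f ∘ (splitCoord J).symm) (x, (lam, η))‖ₑ ^ 2 := by
          rw [lintegral_plancherelMeasure]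
          refine lintegral_congr_ae ?_
          filter_upwards [ae_mem_Sigma (J := J)] with lam hlam
          exact lintegral_kernel_mul_det hgm lam hlam
      _ = _ := by
          rw [lintegral_partialFourier hgm hg hg2]
          exact hmp.lintegral_comp_emb (splitCoord J).symm.measurableEmbedding (fun a => ‖f a‖ₑ ^ 2)
  rw [Lp.norm_def, Lp.norm_def, (ENNReal.pow_right_strictMono two_ne_zero).injective hsq]

/-! ### The closed graph of the Plancherel transform -/

theorem mem_closure_of_mem_plancherelGraph {p : L2N J × L2K J} (h : p ∈ plancherelGraph J) :
    p ∈ closure (fourierGraph J : Set (L2N J × L2K J)) := by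
  rw [plancherelGraph, ← SetLike.mem_coe, Submodule.topologicalClosure_coe] at h
  exact h

theorem norm_eq_of_mem_plancherelGraph {f : L2N J} {K : L2K J} (h : (f, K) ∈ plancherelGraph J) :
    ‖f‖ = ‖K‖ := by
  obtain ⟨p, hp, hlim⟩ := mem_closure_iff_seq_limit.1 (mem_closure_of_mem_plancherelGraph h)
  have h1 := ((continuous_fst.tendsto _).comp hlim).norm
  have h2 := ((continuous_snd.tendsto _).comp hlim).norm
  refine tendsto_nhds_unique h1 (h2.congr fun n => ?_)
  exact (norm_eq_of_mem_fourierGraph (hp n)).symm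

theorem inner_eq_of_mem_plancherelGraph {f g : L2N J} {K M : L2K J}
    (hf : (f, K) ∈ plancherelGraph J) (hg : (g, M) ∈ plancherelGraph J) :
    inner ℂ f g = inner ℂ K M := by
  have hI := (plancherelGraph J).smul_mem Complex.I hg
  have h1 : ‖f + g‖ = ‖K + M‖ := norm_eq_of_mem_plancherelGraph ((plancherelGraph J).add_mem hf hg)
  have h2 : ‖f - g‖ = ‖K - M‖ := norm_eq_of_mem_plancherelGraph ((plancherelGraph J).sub_mem hf hg)
  have h3 : ‖f + Complex.I • g‖ = ‖K + Complex.I • M‖ :=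
    norm_eq_of_mem_plancherelGraph ((plancherelGraph J).add_mem hf hI)
  have h4 : ‖f - Complex.I • g‖ = ‖K - Complex.I • M‖ :=
    norm_eq_of_mem_plancherelGraph ((plancherelGraph J).sub_mem hf hI)
  rw [inner_eq_sum_norm_sq_div_four, inner_eq_sum_norm_sq_div_four]
  simp only [RCLike.I_to_complex, h1, h2, h3, h4]

/-- Continuous maps compatible with the Fourier transform on `L¹ ∩ L²` are compatible with the Plancherel
transform. -/
theorem map_mem_plancherelGraph {U : L2N J → L2N J} {W : L2K J → L2K J} (hU : Continuous U)
    (hW : Continuous W) (h : ∀ f K, (f, K) ∈ fourierGraph J → (U f, W K) ∈ fourierGraph J)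
    {f : L2N J} {K : L2K J} (hf : (f, K) ∈ plancherelGraph J) :
    (U f, W K) ∈ plancherelGraph J := by
  have h1 : Set.MapsTo (Prod.map U W) (fourierGraph J : Set (L2N J × L2K J))
      (fourierGraph J : Set (L2N J × L2K J)) := fun p hp => h p.1 p.2 hp
  have h2 := map_mem_closure (hU.prodMap hW) (mem_closure_of_mem_plancherelGraph hf) h1
  rw [plancherelGraph, ← SetLike.mem_coe, Submodule.topologicalClosure_coe]
  exact h2

/-! ### Covariance under left translations -/

theorem coord_one : coord J 1 = 0 := by
  refine Prod.ext ?_ (Prod.ext ?_ ?_) <;> ext k <;> simp [coord, log_one, brk]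

theorem coord_inv_x (a : NilGroup J) : (coord J a⁻¹).2.2 = -(coord J a).2.2 := by
  have h := coord_mul a⁻¹ a
  rw [inv_mul_cancel, coord_one] at h
  exact eq_neg_of_add_eq_zero_left (congrArg (fun p => p.2.2) h).symm

theorem phase_one (lam : Fin m → ℝ) (t : Fin d → ℝ) : phase lam (coord J 1) t J = 1 := by
  simp [phase, coord_one]

theorem inner_rep_rep (lam : Fin m → ℝ) (a : NilGroup J) (φ ψ : L2R d) :
    inner ℂ (rep lam a φ) (rep lam a ψ) = inner ℂ φ ψ :=
  (LinearIsometry.mk (rep lam a) (norm_rep lam a)).inner_map_map φ ψ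

theorem inner_rep_mul (lam : Fin m → ℝ) (a b : NilGroup J) (φ ψ : L2R d) :
    inner ℂ ψ (rep lam (a * b) φ) = inner ℂ (rep lam a⁻¹ ψ) (rep lam b φ) := by
  rw [← inner_rep_rep lam a⁻¹ ψ, ← LinearMap.comp_apply, ← rep_mul, inv_mul_cancel_left]

/-- This expresses `π_λ(a⁻¹) = π_λ(a)*` on the level of phases. -/
theorem conj_phase_inv (lam : Fin m → ℝ) (a : NilGroup J) (t : Fin d → ℝ) :
    conj (phase lam (coord J a⁻¹) t J) = phase lam (coord J a) (t + (coord J a).2.2) J := by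
  have h := phase_mul lam a⁻¹ a t
  rw [inv_mul_cancel, phase_one, coord_inv_x, sub_neg_eq_add] at h
  have h1 : phase lam (coord J a⁻¹) t J * conj (phase lam (coord J a⁻¹) t J) = 1 := by
    rw [Complex.mul_conj, Complex.normSq_eq_norm_sq, norm_phase]
    simp
  have h0 : phase lam (coord J a⁻¹) t J ≠ 0 := norm_ne_zero_iff.1 (by rw [norm_phase]; simp)
  exact mul_left_cancel₀ h0 (h1.trans h)

theorem measurable_phase (a : NilGroup J) :
    Measurable fun p : (Fin m → ℝ) × (Fin d → ℝ) => phase p.1 (coord J a) p.2 J := by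
  have hB : Continuous fun p : (Fin m → ℝ) × (Fin d → ℝ) => J.B p.1 :=
    continuous_B.comp continuous_fst
  have h : ∀ i j, Continuous fun p : (Fin m → ℝ) × (Fin d → ℝ) => J.B p.1 i j :=
    fun i j => hB.matrix_elem i j
  refine Continuous.measurable ?_
  unfold phase
  simp only [dotProduct, Matrix.mulVec]
  fun_prop

theorem coeFn_L (a : NilGroup J) (f : L2N J) : L a f =ᵐ[haar J] fun b => f (a⁻¹ * b) :=
  Lp.coeFn_compMeasurePreserving f (measurePreserving_mul_left a⁻¹)

theorem measurePreserving_sub_fst (x : Fin d → ℝ) :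
    MeasurePreserving (fun q : (Fin d → ℝ) × (Fin d → ℝ) => (q.1 - x, q.2)) volume volume :=
  (measurePreserving_sub_right volume x).prod (MeasurePreserving.id volume)

theorem measurePreserving_sub_kernel (x : Fin d → ℝ) :
    MeasurePreserving (fun p : (Fin m → ℝ) × ((Fin d → ℝ) × (Fin d → ℝ)) =>
      (p.1, (p.2.1 - x, p.2.2))) (J.plancherelMeasure.prod volume)
      (J.plancherelMeasure.prod volume) :=
  (MeasurePreserving.id _).prod (measurePreserving_sub_fst x)

/-- The action of `L(a)` on kernels: composition with `π_λ(a)` from the left. -/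
theorem exists_weightedComp_L (a : NilGroup J) : ∃ W : L2K J →L[ℂ] L2K J,
    ∀ K, W K =ᵐ[J.plancherelMeasure.prod volume] fun p =>
      phase p.1 (coord J a) p.2.1 J * K (p.1, (p.2.1 - (coord J a).2.2, p.2.2)) := by
  have hT := measurePreserving_sub_kernel (J := J) (coord J a).2.2
  refine exists_weightedComp hT.measurable (c := 1) ENNReal.one_ne_top
    (by rw [hT.map_eq, one_smul]) (w := fun p => phase p.1 (coord J a) p.2.1 J)
    ?_ (C := 1) fun p => (norm_phase _ _ _).le
  exact Measurable.comp (g := fun p : (Fin m → ℝ) × (Fin d → ℝ) => phase p.1 (coord J a) p.2 J)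
    (f := fun p : (Fin m → ℝ) × ((Fin d → ℝ) × (Fin d → ℝ)) => (p.1, p.2.1)) (measurable_phase a)
    (measurable_fst.prodMk (measurable_fst.comp measurable_snd))

/-- The relation `ℱ(L(a)f)(λ) = π_λ(a) ℱf(λ)`. -/
theorem mem_fourierGraph_L (a : NilGroup J) {f : L2N J} {K K' : L2K J}
    (hK' : K' =ᵐ[J.plancherelMeasure.prod volume] fun p =>
      phase p.1 (coord J a) p.2.1 J * K (p.1, (p.2.1 - (coord J a).2.2, p.2.2)))
    (h : (f, K) ∈ fourierGraph J) : (L a f, K') ∈ fourierGraph J := by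
  obtain ⟨hf, hK⟩ := h
  have hmp := measurePreserving_mul_left (J := J)
  refine ⟨(integrable_congr (coeFn_L a f)).2 ((hmp a⁻¹).integrable_comp_of_integrable hf), ?_⟩
  filter_upwards [hK, Measure.ae_ae_of_ae_prod hK'] with lam h1 h2 φ ψ
  let e : NilGroup J ≃ᵐ NilGroup J :=
    { Equiv.mulLeft a with
      measurable_toFun := (hmp a).measurable
      measurable_invFun := (hmp a⁻¹).measurable }
  have he : MeasurePreserving e (haar J) (haar J) := hmp a
  have e1 : ∫ b, L a f b * inner ℂ ψ (rep lam b φ) ∂haar J =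
      ∫ b, f b * inner ℂ (rep lam a⁻¹ ψ) (rep lam b φ) ∂haar J := by
    rw [← he.integral_comp e.measurableEmbedding]
    refine integral_congr_ae ?_
    filter_upwards [he.quasiMeasurePreserving.ae (coeFn_L a f)] with b hb
    rw [hb]
    change f (a⁻¹ * (a * b)) * inner ℂ ψ (rep lam (a * b) φ) = _
    rw [inv_mul_cancel_left, inner_rep_mul]
  have hs := measurePreserving_sub_fst (-(coord J a).2.2)
  have hse : MeasurableEmbedding fun q : (Fin d → ℝ) × (Fin d → ℝ) =>
      (q.1 - -(coord J a).2.2, q.2) :=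
    (MeasurableEquiv.subRight (-(coord J a).2.2)).measurableEmbedding.prodMap
      MeasurableEmbedding.id
  change _ = ∫ b, L a f b * inner ℂ ψ (rep lam b φ) ∂haar J
  rw [e1]
  refine Eq.trans ?_ (h1 φ (rep lam a⁻¹ ψ))
  rw [← hs.integral_comp hse]
  refine integral_congr_ae ?_
  filter_upwards [hs.quasiMeasurePreserving.ae h2, Measure.quasiMeasurePreserving_fst.ae
    (memLp_repFun lam a⁻¹ (Lp.memLp ψ)).coeFn_toLp] with q hq1 hq2
  change K' _ * _ * _ = K (lam, q) * φ q.2 * conj ((memLp_repFun lam a⁻¹ (Lp.memLp ψ)).toLp _ q.1)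
  rw [hq1, hq2, repFun, map_mul, conj_phase_inv, coord_inv_x]
  simp only [sub_neg_eq_add, add_sub_cancel_right]
  ring

/-! ### Covariance under dilations -/

/-- The normalizing factor `2^{-j(n-d)/2} = 2^{-j(m+d)/2}` as a real number. -/
noncomputable def dilReal (m d : ℕ) (j : ℤ) : ℝ := (2 : ℝ) ^ (-((j : ℝ) * ((m : ℝ) + d) / 2))

theorem dilReal_pos (j : ℤ) : 0 < dilReal m d j := Real.rpow_pos_of_pos two_pos _

theorem dilReal_neg (j : ℤ) : dilReal m d (-j) = (dilReal m d j)⁻¹ := by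
  rw [dilReal, dilReal, ← Real.rpow_neg two_pos.le]
  congr 1
  push_cast
  ring

theorem dilReal_sq (j : ℤ) : (dilReal m d j) ^ 2 = (((2 : ℝ) ^ j) ^ (m + d))⁻¹ := by
  rw [dilReal, ← Real.rpow_intCast, ← Real.rpow_natCast, ← Real.rpow_natCast,
    ← Real.rpow_mul two_pos.le, ← Real.rpow_mul two_pos.le, ← Real.rpow_neg two_pos.le]
  congr 1
  push_cast
  ring

variable (J) in
/-- `A^j` as a measurable equivalence. -/
noncomputable def dilM (j : ℤ) : NilGroup J ≃ᵐ NilGroup J where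
  toEquiv := (dil J ^ j : MulAut (NilGroup J)).toEquiv
  measurable_toFun := (quasiMeasurePreserving_dil j).measurable
  measurable_invFun := by
    have h : ⇑(dil J ^ j : MulAut (NilGroup J)).toEquiv.symm =
        (dil J ^ (-j) : MulAut (NilGroup J)) := by
      ext a : 1
      rw [zpow_neg]
      rfl
    rw [h]
    exact (quasiMeasurePreserving_dil (-j)).measurable

/-- The pushforward under `A^j` divides the Haar measure by the determinant `2^{j(m+d)}` of the
differential of `A^j`. -/
theorem map_dil_haar (j : ℤ) : Measure.map (dil J ^ j : MulAut (NilGroup J)) (haar J) =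
    ENNReal.ofReal (dilReal m d j ^ 2) • haar J := by
  have h2 : ((2 : ℝ) ^ j) ≠ 0 := zpow_ne_zero _ two_ne_zero
  let T : Coord m d → Coord m d := Prod.map ((2 : ℝ) ^ j • ·) (Prod.map ((2 : ℝ) ^ j • ·) id)
  have hT : Measurable T := by fun_prop
  have hmT : Measure.map T volume = ENNReal.ofReal (dilReal m d j ^ 2) • volume := by
    rw [Measure.volume_eq_prod, ← Measure.map_prod_map _ _ (by fun_prop) (by fun_prop),
      Measure.volume_eq_prod, ← Measure.map_prod_map _ _ (by fun_prop) (by fun_prop),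
      Measure.map_addHaar_smul _ h2, Measure.map_addHaar_smul _ h2, Measure.map_id,
      Measure.prod_smul_left, Measure.prod_smul_left, Measure.prod_smul_right, smul_smul,
      ← ENNReal.ofReal_mul (abs_nonneg _), ← abs_mul, ← mul_inv, ← pow_add,
      Module.finrank_fin_fun, Module.finrank_fin_fun, ← dilReal_sq, abs_of_nonneg (sq_nonneg _)]
  have heq : (dil J ^ j : MulAut (NilGroup J)) = (coordM J).symm ∘ T ∘ coordM J := by
    ext a : 1
    apply (coordM J).injective
    simp only [Function.comp_apply, MeasurableEquiv.apply_symm_apply]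
    exact coord_dil_zpow j a
  rw [heq, ← Measure.map_map (coordM J).symm.measurable (hT.comp (coordM J).measurable),
    ← Measure.map_map hT (coordM J).measurable, measurePreserving_coordM.map_eq, hmT,
    Measure.map_smul, haar]

theorem coeFn_D (j : ℤ) (f : L2N J) :
    D j f =ᵐ[haar J] fun a => (dilReal m d j : ℂ) * f ((dil J ^ (-j)) a) :=
  ((memLp_comp_dil j f).const_mul (dilFactor m d j)).coeFn_toLp

theorem norm_D (j : ℤ) (f : L2N J) : ‖D j f‖ = ‖f‖ := by
  have h : eLpNorm (D j f) 2 (haar J) ^ 2 = eLpNorm f 2 (haar J) ^ 2 := by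
    rw [eLpNorm_two_sq, eLpNorm_two_sq]
    have h1 := lintegral_map (μ := haar J)
      ((Lp.stronglyMeasurable f).measurable.enorm.pow_const 2)
      (quasiMeasurePreserving_dil (J := J) (-j)).measurable
    rw [map_dil_haar, lintegral_smul_measure, dilReal_neg] at h1
    have hp := dilReal_pos (m := m) (d := d) j
    calc _ = ∫⁻ a, ENNReal.ofReal (dilReal m d j ^ 2) * ‖f ((dil J ^ (-j)) a)‖ₑ ^ 2 ∂haar J := by
          refine lintegral_congr_ae ?_
          filter_upwards [coeFn_D j f] with a ha
          rw [ha, enorm_mul, mul_pow, ← ofReal_norm, Complex.norm_real, Real.norm_of_nonneg hp.le,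
            ENNReal.ofReal_pow hp.le]
      _ = _ := by
          rw [lintegral_const_mul' _ _ ENNReal.ofReal_ne_top, ← h1, smul_eq_mul, ← mul_assoc,
            ← ENNReal.ofReal_mul (sq_nonneg _), inv_pow, mul_inv_cancel₀ (pow_pos hp 2).ne',
            ENNReal.ofReal_one, one_mul]
  rw [Lp.norm_def, Lp.norm_def, (ENNReal.pow_right_strictMono two_ne_zero).injective h]

/-- The Plancherel measure is homogeneous: `|det B(λ)|` contributes `2^{-jd}` and `dλ` contributes
`2^{-jm}`. -/
theorem map_smul_plancherelMeasure (j : ℤ) :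
    Measure.map ((2 : ℝ) ^ j • · : (Fin m → ℝ) → Fin m → ℝ) J.plancherelMeasure =
      ENNReal.ofReal (dilReal m d j ^ 2) • J.plancherelMeasure := by
  have h2 : ((2 : ℝ) ^ j) ≠ 0 := zpow_ne_zero _ two_ne_zero
  have hmeas : Measurable ((2 : ℝ) ^ j • · : (Fin m → ℝ) → Fin m → ℝ) := by fun_prop
  refine Measure.ext_of_lintegral _ fun F hF => ?_
  rw [lintegral_map hF hmeas, lintegral_smul_measure, lintegral_plancherelMeasure,
    lintegral_plancherelMeasure]
  have hG : Measurable fun lam : Fin m → ℝ => ENNReal.ofReal |(J.B lam).det| * F lam :=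
    (continuous_B.matrix_det.abs.measurable).ennreal_ofReal.mul hF
  have h := lintegral_map (μ := volume) hG hmeas
  rw [Measure.map_addHaar_smul _ h2, lintegral_smul_measure, Module.finrank_fin_fun] at h
  have hdet : ∀ lam : Fin m → ℝ, ENNReal.ofReal |(J.B lam).det| =
      ENNReal.ofReal |(((2 : ℝ) ^ j) ^ d)⁻¹| * ENNReal.ofReal |(J.B ((2 : ℝ) ^ j • lam)).det| :=
    fun lam => by
      rw [B_smul, Matrix.det_smul, Fintype.card_fin, ← ENNReal.ofReal_mul (abs_nonneg _),
        ← abs_mul, inv_mul_cancel_left₀ (pow_ne_zero _ h2)]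
  have hcongr : ∀ lam : Fin m → ℝ,
      ENNReal.ofReal |(J.B lam).det| * F ((2 : ℝ) ^ j • lam) =
      ENNReal.ofReal |(((2 : ℝ) ^ j) ^ d)⁻¹| *
        (ENNReal.ofReal |(J.B ((2 : ℝ) ^ j • lam)).det| * F ((2 : ℝ) ^ j • lam)) := fun lam => by
    rw [hdet lam, mul_assoc]
  rw [lintegral_congr hcongr, lintegral_const_mul' _ _ ENNReal.ofReal_ne_top, ← h,
    smul_eq_mul, smul_eq_mul, ← mul_assoc, ← ENNReal.ofReal_mul (abs_nonneg _), ← abs_mul,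
    ← mul_inv, ← pow_add, add_comm d m, ← dilReal_sq, abs_of_nonneg (sq_nonneg _)]

theorem map_smul_prod_plancherelMeasure (j : ℤ) {α : Type*} [MeasurableSpace α] (ν : Measure α)
    [SFinite ν] : Measure.map (Prod.map ((2 : ℝ) ^ j • ·) id)
      (J.plancherelMeasure.prod ν) =
      ENNReal.ofReal (dilReal m d j ^ 2) • J.plancherelMeasure.prod ν := by
  rw [← Measure.map_prod_map _ _ (by fun_prop) (by fun_prop), map_smul_plancherelMeasure,
    Measure.map_id, Measure.prod_smul_left]

/-- The action of `D_{A^j}` on kernels. -/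
theorem exists_weightedComp_D (j : ℤ) : ∃ W : L2K J →L[ℂ] L2K J,
    ∀ K, W K =ᵐ[J.plancherelMeasure.prod volume] fun p =>
      ((dilReal m d j)⁻¹ : ℂ) * K ((2 : ℝ) ^ j • p.1, p.2) :=
  exists_weightedComp (T := Prod.map ((2 : ℝ) ^ j • ·) id) (by fun_prop) ENNReal.ofReal_ne_top
    (map_smul_prod_plancherelMeasure j volume) (w := fun _ => ((dilReal m d j)⁻¹ : ℂ))
    measurable_const fun _ => le_rfl

/-- The automorphism `A^j` scales the central character: `π_λ ∘ A^j = π_{2^j λ}`. -/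
theorem rep_dil (lam : Fin m → ℝ) (j : ℤ) (a : NilGroup J) (φ : L2R d) :
    rep lam ((dil J ^ j) a) φ = rep ((2 : ℝ) ^ j • lam) a φ := by
  change (memLp_repFun lam _ (Lp.memLp φ)).toLp _ = (memLp_repFun _ a (Lp.memLp φ)).toLp _
  refine MemLp.toLp_congr _ _ (Filter.Eventually.of_forall fun t => ?_)
  simp only [repFun, coord_dil_zpow, phase, B_smul, Matrix.smul_mulVec, Matrix.mulVec_smul,
    smul_dotProduct, dotProduct_smul]

/-- The relation `ℱ(D_{A^j}f)(λ) = 2^{j(m+d)/2} ℱf(2^j λ)`. -/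
theorem mem_fourierGraph_D (j : ℤ) {f : L2N J} {K K' : L2K J}
    (hK' : K' =ᵐ[J.plancherelMeasure.prod volume] fun p =>
      ((dilReal m d j)⁻¹ : ℂ) * K ((2 : ℝ) ^ j • p.1, p.2))
    (h : (f, K) ∈ fourierGraph J) : (D j f, K') ∈ fourierGraph J := by
  obtain ⟨hf, hK⟩ := h
  have hp := dilReal_pos (m := m) (d := d) j
  have hint : ∀ (i : ℤ) {F : NilGroup J → ℂ}, Integrable F (haar J) →
      Integrable (fun a => F ((dil J ^ i) a)) (haar J) := fun i F hF => by
    refine Integrable.comp_measurable (f := dilM J i) ?_ (dilM J i).measurable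
    change Integrable F (Measure.map (dil J ^ i : MulAut (NilGroup J)) (haar J))
    rw [map_dil_haar]
    exact hF.smul_measure ENNReal.ofReal_ne_top
  have hq : Measure.QuasiMeasurePreserving ((2 : ℝ) ^ j • · : (Fin m → ℝ) → Fin m → ℝ)
      J.plancherelMeasure J.plancherelMeasure :=
    ⟨by fun_prop, by rw [map_smul_plancherelMeasure]; exact Measure.smul_absolutelyContinuous⟩
  refine ⟨(integrable_congr (coeFn_D j f)).2 ((hint (-j) hf).const_mul _), ?_⟩
  filter_upwards [hq.ae hK, Measure.ae_ae_of_ae_prod hK'] with lam h1 h2 φ ψ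
  have e1 : ∫ a, D j f a * inner ℂ ψ (rep lam a φ) ∂haar J =
      ((dilReal m d j)⁻¹ : ℂ) *
        ∫ a, f a * inner ℂ ψ (rep ((2 : ℝ) ^ j • lam) a φ) ∂haar J := by
    have h3 : ∫ a, D j f a * inner ℂ ψ (rep lam a φ) ∂haar J = ∫ a, (dilReal m d j : ℂ) *
        (f ((dil J ^ (-j)) a) * inner ℂ ψ (rep lam a φ)) ∂haar J := by
      refine integral_congr_ae ?_
      filter_upwards [coeFn_D j f] with a ha
      rw [ha, mul_assoc]
    have h4 := integral_map_equiv (μ := haar J) (dilM J j)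
      fun a => f ((dil J ^ (-j)) a) * inner ℂ ψ (rep lam a φ)
    have h5 : Measure.map (dilM J j) (haar J) = _ := map_dil_haar j
    have h6 : ∀ a : NilGroup J, f ((dil J ^ (-j)) (dilM J j a)) * inner ℂ ψ
        (rep lam (dilM J j a) φ) = f a * inner ℂ ψ (rep ((2 : ℝ) ^ j • lam) a φ) := fun a => by
      change f ((dil J ^ (-j)) ((dil J ^ j) a)) * inner ℂ ψ (rep lam ((dil J ^ j) a) φ) = _
      rw [← MulAut.mul_apply, ← zpow_add, neg_add_cancel, zpow_zero, MulAut.one_apply, rep_dil]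
    rw [h5, integral_smul_measure, ENNReal.toReal_ofReal (sq_nonneg _)] at h4
    simp_rw [h6] at h4
    rw [h3, integral_const_mul, ← h4, Complex.real_smul]
    have : (dilReal m d j : ℂ) ≠ 0 := Complex.ofReal_ne_zero.2 hp.ne'
    push_cast
    field_simp
  change _ = ∫ a, D j f a * inner ℂ ψ (rep lam a φ) ∂haar J
  rw [e1, ← show _ = ∫ a, f a * inner ℂ ψ (rep ((2 : ℝ) ^ j • lam) a φ) ∂haar J from h1 φ ψ,
    ← integral_const_mul]
  refine integral_congr_ae ?_
  filter_upwards [h2] with q hq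
  change K' _ * _ * _ = _ * (K _ * _ * _)
  rw [hq]
  ring

/-! ### Action on the spaces `H S u` -/

theorem mem_H {S : Set (Fin m → ℝ)} {u : L2R d} {f : L2N J} :
    f ∈ H J S u ↔ ∃ K ∈ fiberSpace J S u, (f, K) ∈ plancherelGraph J := by
  constructor
  · rintro ⟨⟨g, K⟩, ⟨h1, h2⟩, rfl⟩
    exact ⟨K, h2.2, h1⟩
  · rintro ⟨K, h1, h2⟩
    exact ⟨(f, K), ⟨h2, trivial, h1⟩, rfl⟩

theorem L_mem_H (a : NilGroup J) {S : Set (Fin m → ℝ)} {u : L2R d} {f : L2N J}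
    (hf : f ∈ H J S u) : L a f ∈ H J S u := by
  obtain ⟨K, ⟨φ, hφ, hK⟩, hfK⟩ := mem_H.1 hf
  obtain ⟨W, hW⟩ := exists_weightedComp_L a
  refine mem_H.2 ⟨W K, ⟨fun p => phase p.1 (coord J a) p.2 J *
    φ (p.1, p.2 - (coord J a).2.2), ?_, ?_⟩,
    map_mem_plancherelGraph (L a).continuous W.continuous
      (fun f K h => mem_fourierGraph_L a (hW K) h) hfK⟩
  · have hT : MeasurePreserving (Prod.map id (· - (coord J a).2.2) :
        (Fin m → ℝ) × (Fin d → ℝ) → _) ((J.plancherelMeasure.restrict S).prod volume)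
        ((J.plancherelMeasure.restrict S).prod volume) :=
      (MeasurePreserving.id _).prod (measurePreserving_sub_right volume _)
    refine (hφ.comp_measurePreserving hT).congr_norm ?_ (Filter.Eventually.of_forall fun p => ?_)
    · exact (measurable_phase a).aestronglyMeasurable.mul (hφ.comp_measurePreserving hT).1
    · rw [norm_mul, norm_phase, one_mul]
      rfl
  · filter_upwards [hW K, (measurePreserving_sub_kernel (J := J)
      (coord J a).2.2).quasiMeasurePreserving.ae hK] with p h1 h2
    rw [h1, h2]
    by_cases hp : p.1 ∈ S <;> simp [hp, mul_assoc]

open scoped Pointwise in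
theorem D_mem_H (j : ℤ) {S : Set (Fin m → ℝ)} (hS : MeasurableSet S) {u : L2R d} {f : L2N J}
    (hf : f ∈ H J S u) : D j f ∈ H J ((2 : ℝ) ^ (-j) • S) u := by
  have h2 : ((2 : ℝ) ^ j) ≠ 0 := zpow_ne_zero _ two_ne_zero
  obtain ⟨K, ⟨φ, hφ, hK⟩, hfK⟩ := mem_H.1 hf
  obtain ⟨W, hW⟩ := exists_weightedComp_D (J := J) j
  have hS' : (2 : ℝ) ^ (-j) • S = ((2 : ℝ) ^ j • ·) ⁻¹' S := by
    rw [zpow_neg, Set.preimage_smul₀ h2]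
  have hDc : Continuous (D j : L2N J → L2N J) :=
    (LinearIsometry.mk (D j) (norm_D j)).continuous
  refine mem_H.2 ⟨W K, ⟨fun p => ((dilReal m d j)⁻¹ : ℂ) * φ ((2 : ℝ) ^ j • p.1, p.2), ?_, ?_⟩,
    map_mem_plancherelGraph hDc W.continuous
      (fun f K h => mem_fourierGraph_D j (hW K) h) hfK⟩
  · refine MemLp.const_mul ?_ _
    have hm : Measurable (Prod.map ((2 : ℝ) ^ j • ·) id :
        (Fin m → ℝ) × (Fin d → ℝ) → (Fin m → ℝ) × (Fin d → ℝ)) := by fun_prop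
    have h3 : MemLp φ 2 (Measure.map (Prod.map ((2 : ℝ) ^ j • ·) id)
        ((J.plancherelMeasure.restrict ((2 : ℝ) ^ (-j) • S)).prod
          (volume : Measure (Fin d → ℝ)))) := by
      rw [← Measure.map_prod_map _ _ (by fun_prop) (by fun_prop), hS',
        ← Measure.restrict_map (by fun_prop) hS, map_smul_plancherelMeasure, Measure.map_id,
        Measure.restrict_smul, Measure.prod_smul_left]
      exact hφ.smul_measure ENNReal.ofReal_ne_top
    exact h3.comp_of_map hm.aemeasurable
  · have hq : Measure.QuasiMeasurePreserving (Prod.map ((2 : ℝ) ^ j • ·) id :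
        (Fin m → ℝ) × ((Fin d → ℝ) × (Fin d → ℝ)) → _)
        (J.plancherelMeasure.prod volume) (J.plancherelMeasure.prod volume) :=
      ⟨by fun_prop, by
        rw [map_smul_prod_plancherelMeasure]; exact Measure.smul_absolutelyContinuous⟩
    filter_upwards [hW K, hq.ae hK] with p h3 h4
    have h5 : p.1 ∈ (2 : ℝ) ^ (-j) • S ↔ (2 : ℝ) ^ j • p.1 ∈ S := by rw [hS']; rfl
    simp only [Prod.map_fst, Prod.map_snd, id] at h4
    change K ((2 : ℝ) ^ j • p.1, p.2) = _ at h4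
    rw [h3, h4]
    by_cases hp : p.1 ∈ (2 : ℝ) ^ (-j) • S
    · rw [Set.indicator_of_mem hp, Set.indicator_of_mem (h5.1 hp), mul_assoc]
    · rw [Set.indicator_of_notMem hp, Set.indicator_of_notMem fun h => hp (h5.2 h), mul_zero]

theorem D_D_neg (j : ℤ) (f : L2N J) : D j (D (-j) f) = f := by
  refine Lp.ext ?_
  filter_upwards [coeFn_D j (D (-j) f), (quasiMeasurePreserving_dil (J := J) (-j)).ae
    (coeFn_D (-j) f)] with a h1 h2
  have : (dilReal m d j : ℂ) ≠ 0 := Complex.ofReal_ne_zero.2 (dilReal_pos j).ne'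
  rw [h1, h2, neg_neg, ← MulAut.mul_apply, ← zpow_add, add_neg_cancel, zpow_zero,
    MulAut.one_apply, dilReal_neg, Complex.ofReal_inv, mul_inv_cancel_left₀ this]

theorem L_dil_D (j : ℤ) (a : NilGroup J) (f : L2N J) :
    L ((dil J ^ j) a) (D j f) = D j (L a f) := by
  refine Lp.ext ?_
  filter_upwards [coeFn_L ((dil J ^ j) a) (D j f), coeFn_D j (L a f),
    (measurePreserving_mul_left ((dil J ^ j) a)⁻¹).quasiMeasurePreserving.ae (coeFn_D j f),
    (quasiMeasurePreserving_dil (J := J) (-j)).ae (coeFn_L a f)] with b h1 h2 h3 h4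
  rw [h1, h2, h3, h4, map_mul, map_inv, ← MulAut.mul_apply, ← zpow_add, neg_add_cancel, zpow_zero,
    MulAut.one_apply]

/-! ### The dyadic annuli -/

/-- In the sup norm, `E` is the annulus `1/4 < ‖λ‖ ≤ 1/2` within `Σ`. -/
theorem mem_E {lam : Fin m → ℝ} :
    lam ∈ J.E ↔ ‖lam‖ ∈ Set.Ioc (1 / 4 : ℝ) (1 / 2) ∧ lam ∈ J.Sigma := by
  have h : ∀ r : ℝ, 0 ≤ r → (lam ∈ Set.Icc (fun _ => -r) (fun _ => r) ↔ ‖lam‖ ≤ r) :=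
    fun r hr => by
      rw [pi_norm_le_iff_of_nonneg hr]
      simp [Pi.le_def, abs_le, forall_and]
  rw [JHBasis.E, Set.mem_inter_iff, Set.mem_sdiff, h _ (by norm_num), h _ (by norm_num), not_le,
    Set.mem_Ioc, and_comm (a := ‖lam‖ ≤ 1 / 2)]

theorem smul_mem_Sigma {c : ℝ} (hc : c ≠ 0) {lam : Fin m → ℝ} :
    c • lam ∈ J.Sigma ↔ lam ∈ J.Sigma := by
  simp [JHBasis.Sigma, B_smul, hc]

open scoped Pointwise in
theorem mem_zpow_smul_E {j : ℤ} {lam : Fin m → ℝ} : lam ∈ (2 : ℝ) ^ (-j) • J.E ↔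
    (2 : ℝ) ^ j * ‖lam‖ ∈ Set.Ioc (1 / 4 : ℝ) (1 / 2) ∧ lam ∈ J.Sigma := by
  have h2 : ((2 : ℝ) ^ j) ≠ 0 := zpow_ne_zero _ two_ne_zero
  have hp : (0 : ℝ) < 2 ^ j := zpow_pos two_pos j
  rw [zpow_neg, Set.mem_inv_smul_set_iff₀ h2, mem_E, smul_mem_Sigma h2, norm_smul,
    Real.norm_of_nonneg hp.le]

theorem measurableSet_E : MeasurableSet J.E :=
  (measurableSet_Icc.diff measurableSet_Icc).inter measurableSet_Sigma

open scoped Pointwise in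
theorem measurableSet_zpow_smul_E (j : ℤ) : MeasurableSet ((2 : ℝ) ^ j • J.E) :=
  measurableSet_E.const_smul₀ _

open scoped Pointwise in
theorem disjoint_zpow_smul_E {i j : ℤ} (hij : i ≠ j) :
    Disjoint ((2 : ℝ) ^ (-i) • J.E) ((2 : ℝ) ^ (-j) • J.E) := by
  have key : ∀ {i j : ℤ}, i < j → ∀ lam : Fin m → ℝ, lam ∈ (2 : ℝ) ^ (-i) • J.E →
      lam ∈ (2 : ℝ) ^ (-j) • J.E → False := fun {i j} hij lam hi hj => by
    obtain ⟨⟨h1, _⟩, _⟩ := mem_zpow_smul_E.1 hi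
    obtain ⟨⟨_, h2⟩, _⟩ := mem_zpow_smul_E.1 hj
    have h3 : (2 : ℝ) ^ (i + 1) ≤ 2 ^ j := zpow_le_zpow_right₀ one_le_two hij
    rw [zpow_add_one₀ two_ne_zero] at h3
    nlinarith [mul_le_mul_of_nonneg_right h3 (norm_nonneg lam)]
  rw [Set.disjoint_left]
  intro lam hi hj
  rcases hij.lt_or_gt with h | h
  · exact key h lam hi hj
  · exact key h lam hj hi

open scoped Pointwise in
theorem exists_mem_zpow_smul_E [NeZero d] {lam : Fin m → ℝ} (h : lam ∈ J.Sigma) :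
    ∃ j : ℤ, lam ∈ (2 : ℝ) ^ (-j) • J.E := by
  have h0 : lam ≠ 0 := by
    rintro rfl
    apply h
    rw [show J.B 0 = 0 from (linB J).map_zero, Matrix.det_zero]
  obtain ⟨n, hn1, hn2⟩ := exists_mem_Ioc_zpow (norm_pos_iff.2 h0) (one_lt_two (α := ℝ))
  -- `2^n < ‖λ‖ ≤ 2^(n+1)` is rescaled to `1/4 < 2^j ‖λ‖ ≤ 1/2`.
  refine ⟨-n - 2, mem_zpow_smul_E.2 ⟨?_, h⟩⟩
  have hp : (0 : ℝ) < 2 ^ n := zpow_pos two_pos n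
  rw [zpow_add_one₀ two_ne_zero] at hn2
  rw [zpow_sub₀ two_ne_zero, zpow_neg]
  constructor
  · rw [div_mul_eq_mul_div, lt_div_iff₀ (by norm_num), lt_inv_mul_iff₀ hp]
    norm_num
    exact hn1
  · rw [div_mul_eq_mul_div, div_le_iff₀ (by norm_num), inv_mul_le_iff₀ hp]
    norm_num
    exact hn2

/-- If `d = 0`, then the centre contains a basis of `𝔫`. -/
theorem neZero_of_not_isLieAbelian (J : JHBasis 𝔫 m d) (h : ¬ IsLieAbelian 𝔫) : NeZero d := by
  refine ⟨fun hd => h ⟨fun a b => ?_⟩⟩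
  subst hd
  refine (JHBasis.lie_eq_zero_of_mem_center ?_ a).1
  rw [← J.basis.sum_repr b]
  refine sum_mem fun i _ => (LieAlgebra.center ℝ 𝔫).smul_mem _ ?_
  rcases i with i | i | i
  · exact J.Z_mem_center i
  · exact i.elim0
  · exact i.elim0

/-! ### The range of the Plancherel transform -/

theorem isClosed_plancherelGraph : IsClosed (plancherelGraph J : Set (L2N J × L2K J)) :=
  (fourierGraph J).isClosed_topologicalClosure

theorem norm_eq_norm_snd {p : L2N J × L2K J} (h : p ∈ plancherelGraph J) : ‖p‖ = ‖p.2‖ := by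
  have h1 : ‖p.1‖ = ‖p.2‖ := norm_eq_of_mem_plancherelGraph (f := p.1) (K := p.2) h
  rw [Prod.norm_def, h1, max_self]

theorem isClosed_map_snd_plancherelGraph :
    IsClosed ((plancherelGraph J).map (LinearMap.snd ℂ (L2N J) (L2K J)) : Set (L2K J)) := by
  have := (isClosed_plancherelGraph (J := J)).completeSpace_coe
  let I : plancherelGraph J →ₗᵢ[ℂ] L2K J :=
    ⟨(LinearMap.snd ℂ (L2N J) (L2K J)).domRestrict (plancherelGraph J),
      fun p => (norm_eq_norm_snd p.2).symm⟩
  have h := I.isometry.isClosedEmbedding.isClosed_range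
  convert h using 1
  ext K
  constructor
  · rintro ⟨p, hp, rfl⟩
    exact ⟨⟨p, hp⟩, rfl⟩
  · rintro ⟨p, rfl⟩
    exact ⟨p.1, p.2, rfl⟩

theorem isClosed_H {S : Set (Fin m → ℝ)} {u : L2R d}
    (h : IsClosed (fiberSpace J S u : Set (L2K J))) : IsClosed (H J S u : Set (L2N J)) := by
  have hc : IsClosed ((plancherelGraph J ⊓ Submodule.prod ⊤ (fiberSpace J S u) :
      Submodule ℂ (L2N J × L2K J)) : Set (L2N J × L2K J)) :=
    isClosed_plancherelGraph.inter (isClosed_univ.prod h)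
  have := hc.completeSpace_coe
  let I : (plancherelGraph J ⊓ Submodule.prod ⊤ (fiberSpace J S u) :
      Submodule ℂ (L2N J × L2K J)) →ₗᵢ[ℂ] L2N J :=
    ⟨(LinearMap.fst ℂ (L2N J) (L2K J)).domRestrict _, fun p => by
      have h1 : ‖p.1.1‖ = ‖p.1.2‖ :=
        norm_eq_of_mem_plancherelGraph (f := p.1.1) (K := p.1.2) p.2.1
      exact h1.trans (norm_eq_norm_snd p.2.1).symm⟩
  have h := I.isometry.isClosedEmbedding.isClosed_range
  convert h using 1
  ext f
  constructor
  · rintro ⟨p, hp, rfl⟩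
    exact ⟨⟨p, hp⟩, rfl⟩
  · rintro ⟨p, rfl⟩
    exact ⟨p.1, p.2, rfl⟩

/-- Translation by the central element `exp(∑ z_k Z_k)` multiplies the kernel by the character
`e^{2πi⟨λ, z⟩}`. -/
theorem exists_mem_plancherelGraph_modulation {f : L2N J} {K : L2K J}
    (h : (f, K) ∈ plancherelGraph J) (z : Fin m → ℝ) : ∃ g M, (g, M) ∈ plancherelGraph J ∧
      M =ᵐ[J.plancherelMeasure.prod volume] fun p =>
        Complex.exp (((2 * Real.pi * (p.1 ⬝ᵥ z) : ℝ) : ℂ) * Complex.I) * K p := by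
  have hc : coord J (ofCoord J (z, 0, 0)) = (z, 0, 0) := (coord J).right_inv _
  obtain ⟨W, hW⟩ := exists_weightedComp_L (ofCoord J (z, 0, 0))
  refine ⟨L (ofCoord J (z, 0, 0)) f, W K, map_mem_plancherelGraph (L _).continuous W.continuous
    (fun f K h => mem_fourierGraph_L _ (hW K) h) h, ?_⟩
  filter_upwards [hW K] with p hp
  rw [hp, hc]
  simp [phase]

theorem exists_ae_eq_indicator (K : L2K J) {S : Set (Fin m → ℝ)} (hS : MeasurableSet S) :
    ∃ M : L2K J, M =ᵐ[J.plancherelMeasure.prod volume] (Prod.fst ⁻¹' S).indicator K :=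
  ⟨_, ((Lp.memLp K).indicator (measurable_fst hS)).coeFn_toLp⟩

/-- The range of the Plancherel transform is invariant under restriction of kernels to a set of `λ`.
For `N` orthogonal to the range, all integrals of `K · conj N` against characters in `λ` vanish, hence
so does the integral over `λ ∈ S`; the range is closed, so it is its own double orthogonal. -/
theorem exists_mem_plancherelGraph_of_indicator {f : L2N J} {K M : L2K J}
    (h : (f, K) ∈ plancherelGraph J) {S : Set (Fin m → ℝ)} (hS : MeasurableSet S)
    (hM : M =ᵐ[J.plancherelMeasure.prod volume] (Prod.fst ⁻¹' S).indicator K) :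
    ∃ g, (g, M) ∈ plancherelGraph J := by
  let R : Submodule ℂ (L2K J) := (plancherelGraph J).map (LinearMap.snd ℂ (L2N J) (L2K J))
  have hR : IsClosed (R : Set (L2K J)) := isClosed_map_snd_plancherelGraph
  have : CompleteSpace R := hR.completeSpace_coe
  suffices hMR : M ∈ R by
    obtain ⟨⟨g, M'⟩, h1, rfl⟩ := hMR
    exact ⟨g, h1⟩
  rw [← Submodule.orthogonal_orthogonal R, Submodule.mem_orthogonal]
  intro N hN
  have hint : Integrable (fun p => K p * conj (N p)) (J.plancherelMeasure.prod volume) := by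
    have := L2.integrable_inner (𝕜 := ℂ) N K
    simpa [RCLike.inner_apply] using this
  have h0 : ∀ z : Fin m → ℝ, ∫ p, K p * conj (N p) *
      Complex.exp (((2 * Real.pi * (p.1 ⬝ᵥ z) : ℝ) : ℂ) * Complex.I)
        ∂(J.plancherelMeasure.prod volume) = 0 := fun z => by
    obtain ⟨g, M', h1, h2⟩ := exists_mem_plancherelGraph_modulation h z
    have h3 : inner ℂ N M' = 0 := by
      rw [← inner_conj_symm, (Submodule.mem_orthogonal R N).1 hN M' ⟨(g, M'), h1, rfl⟩, map_zero]
    rw [L2.inner_def] at h3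
    rw [← h3]
    refine integral_congr_ae ?_
    filter_upwards [h2] with p hp
    rw [hp, RCLike.inner_apply]
    ring
  rw [L2.inner_def, ← setIntegral_preimage_eq_zero measurable_fst hint h0 hS,
    ← integral_indicator (measurable_fst hS)]
  refine integral_congr_ae ?_
  filter_upwards [hM] with p hp
  rw [hp, RCLike.inner_apply]
  by_cases h : p ∈ Prod.fst ⁻¹' S
  · rw [Set.indicator_of_mem h, Set.indicator_of_mem h]
  · rw [Set.indicator_of_notMem h, Set.indicator_of_notMem h, zero_mul]

/-! ### Fields of rank-one operators -/

theorem ae_mem_Sigma_plancherelMeasure : ∀ᵐ lam ∂J.plancherelMeasure, lam ∈ J.Sigma :=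
  (withDensity_absolutelyContinuous _ _).ae_le (ae_restrict_mem measurableSet_Sigma)

theorem eLpNorm_tensor (u : L2R d) {φ : (Fin m → ℝ) × (Fin d → ℝ) → ℂ}
    (hφ : AEStronglyMeasurable φ (J.plancherelMeasure.prod volume)) :
    eLpNorm (fun p : (Fin m → ℝ) × ((Fin d → ℝ) × (Fin d → ℝ)) =>
      φ (p.1, p.2.1) * conj (u p.2.2)) 2 (J.plancherelMeasure.prod volume) =
      eLpNorm φ 2 (J.plancherelMeasure.prod volume) * eLpNorm u 2 volume := by
  apply (ENNReal.pow_right_strictMono two_ne_zero).injective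
  have h := (measurePreserving_prodAssoc J.plancherelMeasure (volume : Measure (Fin d → ℝ))
    (volume : Measure (Fin d → ℝ))).lintegral_comp_emb
    MeasurableEquiv.prodAssoc.measurableEmbedding fun p => ‖φ (p.1, p.2.1) * conj (u p.2.2)‖ₑ ^ 2
  have h2 := lintegral_prod_mul (μ := J.plancherelMeasure.prod (volume : Measure (Fin d → ℝ)))
    (ν := (volume : Measure (Fin d → ℝ))) (hφ.enorm.pow_const 2)
    ((Lp.stronglyMeasurable u).measurable.enorm.pow_const 2).aemeasurable
  simp only [mul_pow]
  rw [eLpNorm_two_sq, eLpNorm_two_sq, eLpNorm_two_sq, ← h2]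
  refine h.symm.trans (lintegral_congr fun p => ?_)
  simp [MeasurableEquiv.prodAssoc, mul_pow]

/-- Forgetting the last variable preserves null sets although that variable has infinite total mass, so
the map is not measure preserving up to a constant. -/
theorem quasiMeasurePreserving_forget_snd : Measure.QuasiMeasurePreserving
    (fun p : (Fin m → ℝ) × ((Fin d → ℝ) × (Fin d → ℝ)) => (p.1, p.2.1))
    (J.plancherelMeasure.prod volume) (J.plancherelMeasure.prod volume) :=
  Measure.quasiMeasurePreserving_fst.comp (measurePreserving_prodAssoc J.plancherelMeasure
    (volume : Measure (Fin d → ℝ)) (volume : Measure (Fin d → ℝ))).symm.quasiMeasurePreserving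

theorem aestronglyMeasurable_tensor (u : L2R d) {φ : (Fin m → ℝ) × (Fin d → ℝ) → ℂ}
    (hφ : AEStronglyMeasurable φ (J.plancherelMeasure.prod volume)) :
    AEStronglyMeasurable (fun p : (Fin m → ℝ) × ((Fin d → ℝ) × (Fin d → ℝ)) =>
      φ (p.1, p.2.1) * conj (u p.2.2)) (J.plancherelMeasure.prod volume) := by
  refine (hφ.comp_quasiMeasurePreserving quasiMeasurePreserving_forget_snd).mul
    (Measurable.aestronglyMeasurable ?_)
  exact RCLike.continuous_conj.measurable.comp ((Lp.stronglyMeasurable u).measurable.comp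
    (measurable_snd.comp measurable_snd))

/-- For a unit vector `u`, the map `φ ↦ φ ⊗ u` is an isometry of `L²(Σ × ℝᵈ)` onto the fields of rank-one
operators. -/
theorem isClosed_fiberSpace_Sigma {u : L2R d} (hu : ‖u‖ = 1) :
    IsClosed (fiberSpace J J.Sigma u : Set (L2K J)) := by
  have hu1 : eLpNorm u 2 volume = 1 := by
    rw [← Lp.enorm_def, ← ofReal_norm, hu, ENNReal.ofReal_one]
  have hmem : ∀ {φ : (Fin m → ℝ) × (Fin d → ℝ) → ℂ},
      MemLp φ 2 (J.plancherelMeasure.prod volume) →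
      MemLp (fun p : (Fin m → ℝ) × ((Fin d → ℝ) × (Fin d → ℝ)) =>
        φ (p.1, p.2.1) * conj (u p.2.2)) 2 (J.plancherelMeasure.prod volume) := fun {φ} hφ =>
    ⟨aestronglyMeasurable_tensor u hφ.1, by
      rw [eLpNorm_tensor u hφ.1, hu1, mul_one]
      exact hφ.2⟩
  have hq := quasiMeasurePreserving_forget_snd (J := J)
  let I : Lp ℂ 2 (J.plancherelMeasure.prod (volume : Measure (Fin d → ℝ))) →ₗᵢ[ℂ] L2K J :=
    { toFun := fun φ => (hmem (Lp.memLp φ)).toLp _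
      map_add' := fun φ ψ => by
        rw [← MemLp.toLp_add]
        refine MemLp.toLp_congr _ _ ?_
        filter_upwards [hq.ae (Lp.coeFn_add φ ψ)] with p hp
        simp only [Pi.add_apply] at hp ⊢
        rw [hp, add_mul]
      map_smul' := fun c φ => by
        rw [RingHom.id_apply, ← MemLp.toLp_const_smul]
        refine MemLp.toLp_congr _ _ ?_
        filter_upwards [hq.ae (Lp.coeFn_smul c φ)] with p hp
        simp only [Pi.smul_apply, smul_eq_mul] at hp ⊢
        rw [hp, mul_assoc]
      norm_map' := fun φ => by
        change ‖(hmem (Lp.memLp φ)).toLp _‖ = _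
        rw [Lp.norm_toLp, eLpNorm_tensor u (Lp.memLp φ).1, hu1, mul_one, Lp.norm_def] }
  have hI : ∀ φ, I φ = (hmem (Lp.memLp φ)).toLp _ := fun _ => rfl
  have hrestrict : J.plancherelMeasure.restrict J.Sigma = J.plancherelMeasure :=
    Measure.restrict_eq_self_of_ae_mem ae_mem_Sigma_plancherelMeasure
  have hind : ∀ φ : (Fin m → ℝ) × (Fin d → ℝ) → ℂ,
      ∀ᵐ p ∂J.plancherelMeasure.prod (volume : Measure ((Fin d → ℝ) × (Fin d → ℝ))),
      J.Sigma.indicator (fun lam => φ (lam, p.2.1) * conj (u p.2.2)) p.1 =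
        φ (p.1, p.2.1) * conj (u p.2.2) := fun φ => by
    filter_upwards [Measure.quasiMeasurePreserving_fst.ae
      (ae_mem_Sigma_plancherelMeasure (J := J))] with p hp
    rw [Set.indicator_of_mem hp]
  convert I.isometry.isClosedEmbedding.isClosed_range using 1
  ext K
  constructor
  · rintro ⟨φ, hφ, hK⟩
    rw [hrestrict] at hφ
    refine ⟨hφ.toLp φ, Lp.ext ?_⟩
    filter_upwards [hK, hind φ, hq.ae hφ.coeFn_toLp,
      (hmem (Lp.memLp (hφ.toLp φ))).coeFn_toLp] with p h1 h2 h3 h4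
    rw [hI, h4, h1, h2, h3]
  · rintro ⟨φ, rfl⟩
    refine ⟨φ, by rw [hrestrict]; exact Lp.memLp φ, ?_⟩
    filter_upwards [hind φ, (hmem (Lp.memLp φ)).coeFn_toLp] with p h1 h2
    rw [hI, h2, h1]

theorem restrict_prod_eq_restrict_preimage_fst {α β : Type*} [MeasurableSpace α]
    [MeasurableSpace β] {μ : Measure α} {ν : Measure β} [SFinite μ] [SFinite ν] {S A : Set α}
    (hA : MeasurableSet A) (hAS : A ⊆ S) :
    (μ.restrict A).prod ν = ((μ.restrict S).prod ν).restrict (Prod.fst ⁻¹' A) := by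
  rw [← Set.prod_univ, ← Measure.prod_restrict, Measure.restrict_univ, Measure.restrict_restrict hA,
    Set.inter_eq_left.2 hAS]

theorem indicator_mem_fiberSpace {S A : Set (Fin m → ℝ)} (hA : MeasurableSet A) (hAS : A ⊆ S)
    {u : L2R d} {K M : L2K J} (hK : K ∈ fiberSpace J S u)
    (hM : M =ᵐ[J.plancherelMeasure.prod volume] (Prod.fst ⁻¹' A).indicator K) :
    M ∈ fiberSpace J A u := by
  obtain ⟨φ, hφ, hKφ⟩ := hK
  refine ⟨φ, by rw [restrict_prod_eq_restrict_preimage_fst hA hAS]; exact hφ.restrict _, ?_⟩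
  filter_upwards [hM, hKφ] with p h1 h2
  rw [h1]
  by_cases h : p.1 ∈ A
  · rw [Set.indicator_of_mem (Set.mem_preimage.2 h), h2, Set.indicator_of_mem (hAS h),
      Set.indicator_of_mem h]
  · have h' : p ∉ Prod.fst ⁻¹' A := h
    rw [Set.indicator_of_notMem h, Set.indicator_of_notMem h']

theorem fiberSpace_mono {S A : Set (Fin m → ℝ)} (hA : MeasurableSet A) (hAS : A ⊆ S) (u : L2R d) :
    fiberSpace J A u ≤ fiberSpace J S u := by
  rintro K ⟨φ, hφ, hK⟩
  rw [restrict_prod_eq_restrict_preimage_fst hA hAS] at hφ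
  refine ⟨(Prod.fst ⁻¹' A).indicator φ,
    (memLp_indicator_iff_restrict (measurable_fst hA)).2 hφ, ?_⟩
  filter_upwards [hK] with p h1
  rw [h1]
  by_cases h : p.1 ∈ A
  · have h' : (p.1, p.2.1) ∈ (Prod.fst ⁻¹' A : Set ((Fin m → ℝ) × (Fin d → ℝ))) := h
    rw [Set.indicator_of_mem h, Set.indicator_of_mem (hAS h), Set.indicator_of_mem h']
  · have h' : (p.1, p.2.1) ∉ (Prod.fst ⁻¹' A : Set ((Fin m → ℝ) × (Fin d → ℝ))) := h
    rw [Set.indicator_of_notMem h]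
    by_cases hS : p.1 ∈ S
    · rw [Set.indicator_of_mem hS, Set.indicator_of_notMem h', zero_mul]
    · rw [Set.indicator_of_notMem hS]

/-! ### Orthogonality and the direct sum decomposition -/

theorem isOrtho_H {S T : Set (Fin m → ℝ)} (h : Disjoint S T) (u : L2R d) : H J S u ⟂ H J T u := by
  rw [Submodule.isOrtho_iff_inner_eq]
  intro f hf g hg
  obtain ⟨K, ⟨φ, -, hK⟩, hfK⟩ := mem_H.1 hf
  obtain ⟨M, ⟨ψ, -, hM⟩, hgM⟩ := mem_H.1 hg
  rw [inner_eq_of_mem_plancherelGraph hfK hgM, L2.inner_def]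
  refine integral_eq_zero_of_ae ?_
  filter_upwards [hK, hM] with p h1 h2
  rw [h1, h2]
  by_cases hp : p.1 ∈ S
  · rw [Set.indicator_of_notMem (Set.disjoint_left.1 h hp), inner_zero_right]
    rfl
  · rw [Set.indicator_of_notMem hp, inner_zero_left]
    rfl

/-- A countable measurable cover of `Σ` generates `H Σ u`: the component `g` of an element of `H Σ u`
orthogonal to all pieces has a kernel `M` orthogonal to its own restriction to each piece. -/
theorem topologicalClosure_iSup_H {ι : Type*} [Countable ι] {A : ι → Set (Fin m → ℝ)}
    (hA : ∀ i, MeasurableSet (A i)) (hAS : ∀ i, A i ⊆ J.Sigma) (hcov : J.Sigma ⊆ ⋃ i, A i)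
    {u : L2R d} (hu : ‖u‖ = 1) :
    (⨆ i, H J (A i) u).topologicalClosure = H J J.Sigma u := by
  have hle : (⨆ i, H J (A i) u).topologicalClosure ≤ H J J.Sigma u := by
    refine Submodule.topologicalClosure_minimal _ (iSup_le fun i f hf => ?_)
      (isClosed_H (isClosed_fiberSpace_Sigma hu))
    obtain ⟨K, hK, hfK⟩ := mem_H.1 hf
    exact mem_H.2 ⟨K, fiberSpace_mono (hA i) (hAS i) u hK, hfK⟩
  refine le_antisymm hle fun f hf => ?_
  have : CompleteSpace (⨆ i, H J (A i) u).topologicalClosure :=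
    (⨆ i, H J (A i) u).isClosed_topologicalClosure.completeSpace_coe
  obtain ⟨f', hf', g, hg, rfl⟩ :=
    (⨆ i, H J (A i) u).topologicalClosure.exists_add_mem_mem_orthogonal f
  have hgH : g ∈ H J J.Sigma u := by
    simpa using (H J J.Sigma u).sub_mem hf (hle hf')
  obtain ⟨M, hM, hgM⟩ := mem_H.1 hgH
  have hzero : ∀ i, ∀ᵐ p ∂J.plancherelMeasure.prod
      (volume : Measure ((Fin d → ℝ) × (Fin d → ℝ))), p.1 ∈ A i → M p = 0 := fun i => by
    obtain ⟨N, hN⟩ := exists_ae_eq_indicator M (hA i)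
    obtain ⟨h, hh⟩ := exists_mem_plancherelGraph_of_indicator hgM (hA i) hN
    have hmem : h ∈ (⨆ i, H J (A i) u).topologicalClosure :=
      Submodule.le_topologicalClosure _ (Submodule.mem_iSup_of_mem i
        (mem_H.2 ⟨N, indicator_mem_fiberSpace (hA i) (hAS i) hM hN, hh⟩))
    have h1 : inner ℂ N N = 0 := by
      rw [← (Submodule.mem_orthogonal _ _).1 hg h hmem,
        inner_eq_of_mem_plancherelGraph hh hgM, L2.inner_def, L2.inner_def]
      refine integral_congr_ae ?_
      filter_upwards [hN] with p hp
      rw [hp]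
      by_cases hpA : p ∈ Prod.fst ⁻¹' A i
      · rw [Set.indicator_of_mem hpA]
      · rw [Set.indicator_of_notMem hpA, inner_zero_left, inner_zero_left]
    filter_upwards [hN, (Lp.eq_zero_iff_ae_eq_zero).1 (inner_self_eq_zero.1 h1)] with p h2 h3 hp
    rw [← Set.indicator_of_mem (s := Prod.fst ⁻¹' A i) hp M, ← h2, h3]
    rfl
  have hM0 : M = 0 := by
    rw [Lp.eq_zero_iff_ae_eq_zero]
    filter_upwards [ae_all_iff.2 hzero, Measure.quasiMeasurePreserving_fst.ae
      (ae_mem_Sigma_plancherelMeasure (J := J))] with p h1 h2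
    obtain ⟨i, hi⟩ := Set.mem_iUnion.1 (hcov h2)
    exact h1 i hi
  have hg0 : g = 0 := by
    rw [← norm_eq_zero, norm_eq_of_mem_plancherelGraph hgM, hM0, norm_zero]
  rw [hg0, add_zero]
  exact hf'

theorem L_one (f : L2N J) : L 1 f = f := by
  refine Lp.ext ?_
  filter_upwards [coeFn_L 1 f] with b hb
  rw [hb, inv_one, one_mul]

theorem one_mem_Gam : (1 : NilGroup J) ∈ Gam J := by
  refine ⟨0, 0, 0, ?_⟩
  ext
  simp [log_mul, log_one]

theorem D_mem_HEj (j : ℤ) {u : L2R d} {f : L2N J} (hf : f ∈ HE J u) : D j f ∈ HEj J j u :=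
  D_mem_H j measurableSet_E hf

open scoped Pointwise in
theorem D_neg_mem_HE (j : ℤ) {u : L2R d} {f : L2N J} (hf : f ∈ HEj J j u) :
    D (-j) f ∈ HE J u := by
  have h := D_mem_H (-j) (measurableSet_zpow_smul_E (-j)) hf
  rwa [neg_neg, smul_smul, ← zpow_add₀ two_ne_zero, add_neg_cancel, zpow_zero, one_smul] at h

theorem inner_D_D (j : ℤ) (f g : L2N J) : inner ℂ (D j f) (D j g) = inner ℂ f g :=
  (LinearIsometry.mk (D j) (norm_D j)).inner_map_map f g

end NilWavelet

theorem mainTheorem4 {𝔫 : Type*} [LieRing 𝔫] [LieAlgebra ℝ 𝔫] {m d : ℕ} (J : JHBasis 𝔫 m d)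
    (hnc : ¬ IsLieAbelian 𝔫) (u : L2R d) (hu : ‖u‖ = 1) :
    (∀ (j : ℤ), ∀ (γ : NilGroup J) (f : L2N J),
      L ((NilGroup.dil J ^ j) γ) (D j f) = D j (L γ f)) ∧
    (∀ f : L2N J, IsParsevalFrame (HE J u) (fun γ : NilGroup.Gam J => L (γ : NilGroup J) f) →
      ∀ j : ℤ, IsParsevalFrame (HEj J j u)
        (fun γ : NilGroup.Gam J => L ((NilGroup.dil J ^ j) (γ : NilGroup J)) (D j f))) ∧
    (∀ j : ℤ, Set.image2 (fun γ h => D j (L γ h)) (NilGroup.Gam J) (HE J u : Set (L2N J)) =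
      (HEj J j u : Set (L2N J))) ∧
    (∀ j j' : ℤ, j ≠ j' → HEj J j u ⟂ HEj J j' u) ∧
    (⨆ j : ℤ, HEj J j u).topologicalClosure = H J J.Sigma u := by
  have : NeZero d := neZero_of_not_isLieAbelian J hnc
  refine ⟨L_dil_D, fun f hf j => ⟨fun γ => ?_, fun g hg => ?_⟩, fun j => ?_,
    fun i j hij => isOrtho_H (disjoint_zpow_smul_E hij) u,
    topologicalClosure_iSup_H (fun j => measurableSet_zpow_smul_E (-j))
      (fun j lam h => (mem_zpow_smul_E.1 h).2)
      (fun lam h => Set.mem_iUnion.2 (exists_mem_zpow_smul_E h)) hu⟩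
  · change L _ (D j f) ∈ _
    rw [L_dil_D]
    exact D_mem_HEj j (hf.1 γ)
  · have h := hf.2 _ (D_neg_mem_HE j hg)
    have h1 : ∀ γ : NilGroup.Gam J, inner ℂ g (L ((NilGroup.dil J ^ j) (γ : NilGroup J)) (D j f)) =
        inner ℂ (D (-j) g) (L (γ : NilGroup J) f) := fun γ => by
      rw [L_dil_D, ← inner_D_D j (D (-j) g), D_D_neg]
    rw [norm_D] at h
    simpa only [h1] using h
  · ext f
    constructor
    · rintro ⟨γ, -, h, hh, rfl⟩
      exact D_mem_HEj j (L_mem_H γ hh)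
    · intro hf
      exact ⟨1, one_mem_Gam, D (-j) f, D_neg_mem_HE j hf, by
        simp only [L_one, D_D_neg]⟩
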